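/- Let $H$ be a complex Hilbert space and let $T:D(T)\to H$, $D(T)\subseteq H$, be a densely defined, self-adjoint, one-to-one operator that is not bounded (so $H$ is infinite-dimensional). For a linear operator $S:D(S)\to H$ with $D(S)\subseteq H$ put $m(S)=\inf\{\|Sx\|: x\in D(S),\ \|x\|=1\}$, and call $S$ *minimum attaining* if $\|Sx_0\|=m(S)$ for some $x_0\in D(S)$ with $\|x_0\|=1$. Call $T$ *absolutely minimum attaining* if for every closed subspace $M\subseteq H$ with $M\cap D(T)\neq\{0\}$ the restriction $T|_M:D(T)\cap M\to H$ is minimum attaining. Let $\rho(T)$ be the set of all $\lambda\in\mathbb C$ for which $T-\lambda I:D(T)\to H$ is bijective with bounded inverse, and $\sigma(T)=\mathbb C\setminus\rho(T)$. Then the following are equivalent: 1. $T$ is absolutely minimum attaining; 2. $T^{-1}$ is an everywhere defined compact operator on $H$; 3. there are a real sequence $(\lambda_n)_{n\in\mathbb N}$ and an orthonormal basis $\{v_n:n\in\mathbb N\}$ of $H$ such that $\lim_{n\to\infty}|\lambda_n|=\infty$ and, for every $n$, $v_n\in D(T)$ and $Tv_n=\lambda_nv_n$; 4. $T$ has purely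 discrete spectrum, that is, every $\lambda\in\sigma(T)$ is an eigenvalue of finite multiplicity and $\sigma(T)$ has no accumulation point in $\mathbb C$; 5. $(T-\lambda I)^{-1}$ is compact for some $\lambda\in\rho(T)$; equivalently, $(T-\lambda I)^{-1}$ is compact for all $\lambda\in\rho(T)$; 6. the embedding $J_T:(D(T),\|\cdot\|_T)\to H$, $x\mapsto x$, is compact, where $\|x\|_T=(\|x\|^2+\|Tx\|^2)^{1/2}$. -/

import Mathlib

open Filter Topology

noncomputable section

namespace LinearPMap

variable {E F : Type*} [NormedAddCommGroup E] [InnerProductSpace ℂ E]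
  [NormedAddCommGroup F] [InnerProductSpace ℂ F]

/-- A partially defined operator is bounded on its domain. -/
def IsBoundedOp (T : E →ₗ.[ℂ] F) : Prop :=
  ∃ C : ℝ, ∀ x : T.domain, ‖T x‖ ≤ C * ‖(x : E)‖

/-- `T ∈ 𝓑(E, F)`: everywhere defined and bounded. -/
def MemBounded (T : E →ₗ.[ℂ] F) : Prop :=
  T.domain = ⊤ ∧ T.IsBoundedOp

/-- `T ∈ 𝓚(E, F)`: everywhere defined and compact. -/
def MemCompact (T : E →ₗ.[ℂ] F) : Prop :=
  T.domain = ⊤ ∧ IsCompactOperator (T : T.domain → F)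

/-- The minimum modulus `m(T)`, the infimum of `‖T x‖` over unit vectors of the domain. -/
def minModulus (T : E →ₗ.[ℂ] F) : ℝ :=
  sInf {r : ℝ | ∃ x : T.domain, ‖(x : E)‖ = 1 ∧ r = ‖T x‖}

/-- The minimum modulus is attained at a unit vector of the domain. -/
def IsMinAttaining (T : E →ₗ.[ℂ] F) : Prop :=
  ∃ x : T.domain, ‖(x : E)‖ = 1 ∧ ‖T x‖ = T.minModulus

/-- Absolutely minimum attaining: for each closed subspace `M`, the restriction
`T|_M : D(T) ∩ M → F` is minimum attaining, as soon as it has a nonzero vector in its domain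
(otherwise there is no unit vector over which to minimize). -/
def IsAbsMinAttaining (T : E →ₗ.[ℂ] F) : Prop :=
  ∀ M : Submodule ℂ E, _root_.IsClosed (M : Set E) → M ⊓ T.domain ≠ ⊥ →
    (T.domRestrict M).IsMinAttaining

/-- `T - z I`, with domain `D(T)`. -/
def subScalar (T : E →ₗ.[ℂ] E) (z : ℂ) : E →ₗ.[ℂ] E where
  domain := T.domain
  toFun := T.toFun - z • T.domain.subtype

/-- The resolvent `(T - z I)⁻¹`, with domain the range of `T - z I`
(meaningful when `T - z I` is one-to-one). -/
def resolventOp (T : E →ₗ.[ℂ] E) (z : ℂ) : E →ₗ.[ℂ] E :=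
  (T.subScalar z).inverse

/-- The resolvent set: `T - z I` is one-to-one and onto, with bounded inverse. -/
def resolventSet (T : E →ₗ.[ℂ] E) : Set ℂ :=
  {z | Function.Injective (T.subScalar z) ∧ (T.resolventOp z).MemBounded}

/-- The spectrum. -/
def spectrumSet (T : E →ₗ.[ℂ] E) : Set ℂ := T.resolventSetᶜ

/-- The space of solutions `x ∈ D(T)` of `T x = z x`. -/
def eigenspaceAt (T : E →ₗ.[ℂ] E) (z : ℂ) : Submodule ℂ T.domain :=
  LinearMap.ker (T.subScalar z).toFun

/-- Purely discrete spectrum: the spectrum consists of eigenvalues of finite multiplicity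
and has no accumulation point in `ℂ`. -/
def HasPurelyDiscreteSpectrum (T : E →ₗ.[ℂ] E) : Prop :=
  (∀ z ∈ T.spectrumSet, T.eigenspaceAt z ≠ ⊥ ∧ FiniteDimensional ℂ (T.eigenspaceAt z)) ∧
    ∀ z : ℂ, ¬ AccPt z (𝓟 T.spectrumSet)

/-- The domain of `T`, to be equipped with the graph norm. -/
def GraphDomain (T : E →ₗ.[ℂ] F) : Type _ := T.domain

namespace GraphDomain

variable (T : E →ₗ.[ℂ] F)

instance : AddCommGroup T.GraphDomain := inferInstanceAs (AddCommGroup T.domain)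

instance : Module ℂ T.GraphDomain := inferInstanceAs (Module ℂ T.domain)

/-- The embedding `J_T : (D(T), ‖·‖_T) → E`. -/
def embedding : T.GraphDomain →ₗ[ℂ] E := T.domain.subtype

/-- `T` as a map on its domain with the graph norm. -/
def op : T.GraphDomain →ₗ[ℂ] F := T.toFun

/-- The map `x ↦ (x, T x)` into the Hilbert sum of `E` and `F`. -/
def toGraph : T.GraphDomain →ₗ[ℂ] WithLp 2 (E × F) :=
  (WithLp.linearEquiv 2 ℂ (E × F)).symm.toLinearMap ∘ₗ (embedding T).prod (op T)

theorem toGraph_injective : Function.Injective (toGraph T) := by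
  intro x y h
  have h1 := congrArg (fun w : WithLp 2 (E × F) => w.fst) h
  exact Subtype.ext h1

/-- The graph norm, pulled back along `x ↦ (x, T x)`; see `norm_eq`. -/
instance : NormedAddCommGroup T.GraphDomain :=
  NormedAddCommGroup.induced T.GraphDomain (WithLp 2 (E × F)) (toGraph T) (toGraph_injective T)

instance : NormedSpace ℂ T.GraphDomain :=
  NormedSpace.induced ℂ T.GraphDomain (WithLp 2 (E × F)) (toGraph T)

theorem norm_eq (x : T.GraphDomain) :
    ‖x‖ = Real.sqrt (‖embedding T x‖ ^ 2 + ‖op T x‖ ^ 2) :=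
  WithLp.prod_norm_eq_of_L2 (toGraph T x)

end GraphDomain

end LinearPMap

end

/-! Everything reduces to compactness of `A`, the bounded self-adjoint injective inverse of `T`.

A compact `A` has an orthonormal eigenbasis with eigenvalues tending to 0; inverting them gives the
eigenvalues of `T`. Parseval's identity bounds `T - z` below by the distance from `z` to the
eigenvalues, so the spectrum is discrete. Conversely, discreteness puts 0 in the resolvent set and
leaves `A` finitely many spectral values, of finite multiplicity, outside each neighbourhood of 0;
cutting off the rest by functional calculus makes `A` a norm limit of finite-rank operators.
Compactness passes from `A` to every resolvent by `R = (1 + zR)A`, and from one resolvent to the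
graph embedding `J = R(T - z)`. If `J` is compact, a minimizing sequence in `M` has a subsequence
converging in `H`; the parallelogram law makes its images Cauchy, and closedness of `T` shows that
the limit is a minimizer.

The harder step is from absolute minimum attainment to compactness of `A`. Taking `M = H` bounds `T`
below, so `A` exists. If `A` is not compact, then on every finite-codimensional subspace the ratio
`‖A y‖ / ‖y‖` exceeds a fixed `ε` somewhere, and it is arbitrarily small somewhere because `T` is
unbounded. The intermediate value theorem then yields an orthonormal sequence `y n` with orthogonal
images whose norms increase strictly to some `κ`. On the image under `A` of its closed span, `‖T x‖
/ ‖x‖` has infimum `1 / κ`, which is not attained. -/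

section

/-! ### Bounded inverses and the resolvent set -/

namespace LinearPMap

variable {H : Type*} [NormedAddCommGroup H] [InnerProductSpace ℂ H]

local notation "⟪" x ", " y "⟫" => inner ℂ x y

/-- Limits of sequences in the graph of a closed operator. -/
theorem IsClosed.apply_of_tendsto {T : H →ₗ.[ℂ] H} (hT : T.IsClosed) {ι : Type*} {l : Filter ι}
    [l.NeBot] {x : ι → T.domain} {a b : H} (ha : Tendsto (fun i => (x i : H)) l (𝓝 a))
    (hb : Tendsto (fun i => T (x i)) l (𝓝 b)) : ∃ h : a ∈ T.domain, T ⟨a, h⟩ = b := by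
  have h : (a, b) ∈ T.graph := by
    have hc : _root_.IsClosed (T.graph : Set (H × H)) := hT
    exact hc.mem_of_tendsto (ha.prodMk_nhds hb) (Eventually.of_forall fun i => T.mem_graph (x i))
  obtain ⟨y, hy1, hy2⟩ := (T.mem_graph_iff).1 h
  simp only at hy1 hy2
  subst hy1
  exact ⟨y.2, hy2⟩

theorem subScalar_zero (T : H →ₗ.[ℂ] H) : T.subScalar 0 = T := by
  refine LinearPMap.ext rfl ?_
  intro x h1 h2
  change T ⟨x, h2⟩ - (0 : ℂ) • x = T ⟨x, h2⟩
  rw [zero_smul, sub_zero]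

theorem resolventOp_zero (T : H →ₗ.[ℂ] H) : T.resolventOp 0 = T.inverse := by
  rw [resolventOp, subScalar_zero]

theorem mem_eigenspaceAt_iff {T : H →ₗ.[ℂ] H} {z : ℂ} {x : T.domain} :
    x ∈ T.eigenspaceAt z ↔ T x = z • (x : H) :=
  (LinearMap.mem_ker (f := (T.subScalar z).toFun)).trans sub_eq_zero

/-- `R` is a bounded two-sided inverse of `T - z I`. -/
def IsResolventAt (T : H →ₗ.[ℂ] H) (z : ℂ) (R : H →L[ℂ] H) : Prop :=
  (∀ y, ∃ h : R y ∈ T.domain, T ⟨R y, h⟩ - z • R y = y) ∧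
    ∀ x : T.domain, R (T x - z • (x : H)) = x

theorem IsResolventAt.injective {T : H →ₗ.[ℂ] H} {z : ℂ} {R : H →L[ℂ] H}
    (hR : T.IsResolventAt z R) : Function.Injective (T.subScalar z) := by
  intro x y hxy
  have hxy' : T x - z • (x : H) = T y - z • (y : H) := hxy
  apply Subtype.ext
  rw [← hR.2 x, hxy', hR.2 y]

theorem ker_eq_bot_of_injective {T : H →ₗ.[ℂ] H} (h : Function.Injective T) :
    LinearMap.ker T.toFun = ⊥ := LinearMap.ker_eq_bot.2 h

theorem IsResolventAt.resolventOp_domain {T : H →ₗ.[ℂ] H} {z : ℂ} {R : H →L[ℂ] H}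
    (hR : T.IsResolventAt z R) : (T.resolventOp z).domain = ⊤ := by
  rw [resolventOp, inverse_domain, eq_top_iff]
  intro y _
  obtain ⟨h, hy⟩ := hR.1 y
  exact ⟨⟨R y, h⟩, hy⟩

theorem IsResolventAt.resolventOp_apply {T : H →ₗ.[ℂ] H} {z : ℂ} {R : H →L[ℂ] H}
    (hR : T.IsResolventAt z R) (y : (T.resolventOp z).domain) :
    T.resolventOp z y = R y := by
  obtain ⟨h, hy⟩ := hR.1 y
  exact inverse_apply_eq (f := T.subScalar z) (ker_eq_bot_of_injective hR.injective)
    (x := (⟨R y, h⟩ : T.domain)) hy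

theorem IsResolventAt.mem_resolventSet {T : H →ₗ.[ℂ] H} {z : ℂ} {R : H →L[ℂ] H}
    (hR : T.IsResolventAt z R) : z ∈ T.resolventSet := by
  refine ⟨hR.injective, hR.resolventOp_domain, ‖R‖, fun x => ?_⟩
  rw [hR.resolventOp_apply]
  exact R.le_opNorm _

/-- An everywhere defined bounded `(T - z)⁻¹` gives a bounded two-sided inverse. -/
theorem exists_isResolventAt {T : H →ₗ.[ℂ] H} {z : ℂ} (hinj : Function.Injective (T.subScalar z))
    (hb : (T.resolventOp z).MemBounded) : ∃ R, T.IsResolventAt z R := by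
  obtain ⟨hd, C, hC⟩ := hb
  let L : H →ₗ[ℂ] H := (T.resolventOp z).toFun ∘ₗ
    LinearMap.codRestrict (T.resolventOp z).domain LinearMap.id (fun x => hd ▸ Submodule.mem_top)
  have hL : ∀ x (hx : x ∈ (T.resolventOp z).domain), L x = T.resolventOp z ⟨x, hx⟩ :=
    fun x hx => rfl
  have hk := ker_eq_bot_of_injective hinj
  refine ⟨L.mkContinuous C fun x => ?_, fun y => ?_, fun x => ?_⟩
  · rw [hL x (hd ▸ Submodule.mem_top)]
    exact hC _
  · have hy : y ∈ (T.resolventOp z).domain := hd ▸ Submodule.mem_top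
    have hy' := hy
    rw [resolventOp, inverse_domain] at hy'
    obtain ⟨x, hx⟩ := hy'
    have h1 : T.resolventOp z ⟨y, hy⟩ = (x : H) :=
      inverse_apply_eq (f := T.subScalar z) hk (x := x) hx
    have h2 : L y = x := by rw [hL y hy, h1]
    have h3 : L y ∈ T.domain := h2 ▸ x.2
    refine ⟨h3, ?_⟩
    have h4 : (⟨L y, h3⟩ : T.domain) = x := Subtype.ext h2
    change T ⟨L y, h3⟩ - z • L y = y
    rw [h4, h2]
    exact hx
  · have hy : T x - z • (x : H) ∈ (T.resolventOp z).domain := hd ▸ Submodule.mem_top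
    change L _ = _
    rw [hL _ hy]
    exact inverse_apply_eq (f := T.subScalar z) hk (x := x) rfl

theorem mem_resolventSet_iff {T : H →ₗ.[ℂ] H} {z : ℂ} :
    z ∈ T.resolventSet ↔ ∃ R, T.IsResolventAt z R :=
  ⟨fun h => exists_isResolventAt h.1 h.2, fun ⟨_, hR⟩ => hR.mem_resolventSet⟩

theorem IsResolventAt.memCompact_iff {T : H →ₗ.[ℂ] H} {z : ℂ} {R : H →L[ℂ] H}
    (hR : T.IsResolventAt z R) : (T.resolventOp z).MemCompact ↔ IsCompactOperator R := by
  have hd := hR.resolventOp_domain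
  constructor
  · rintro ⟨-, hc⟩
    let ι : H →L[ℂ] (T.resolventOp z).domain :=
      (ContinuousLinearMap.id ℂ H).codRestrict (T.resolventOp z).domain
        (fun x => hd ▸ Submodule.mem_top)
    have h := hc.comp_clm ι
    have e : (R : H → H) = T.resolventOp z ∘ ι :=
      funext fun x => (hR.resolventOp_apply (ι x)).symm
    rwa [e]
  · intro hc
    refine ⟨hd, ?_⟩
    have h := hc.comp_clm (T.resolventOp z).domain.subtypeL
    have e : (T.resolventOp z : (T.resolventOp z).domain → H)
        = R ∘ (T.resolventOp z).domain.subtypeL := funext fun x => hR.resolventOp_apply x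
    rwa [e]

theorem MemCompact.memBounded {S : H →ₗ.[ℂ] H} (h : S.MemCompact) : S.MemBounded := by
  refine ⟨h.1, ?_⟩
  have hc : Continuous S.toFun := IsCompactOperator.continuous (f := S.toFun) h.2
  let L : S.domain →L[ℂ] H := ⟨S.toFun, hc⟩
  exact ⟨‖L‖, fun x => L.le_opNorm x⟩

/-- Trades the partially defined inverse for a bounded operator on all of `H`, to which the theory
of compact operators applies. -/
theorem memCompact_inverse_iff {T : H →ₗ.[ℂ] H} (hinj : Function.Injective T) :
    T.inverse.MemCompact ↔ ∃ A, T.IsResolventAt 0 A ∧ IsCompactOperator A := by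
  rw [← resolventOp_zero]
  constructor
  · intro h
    obtain ⟨A, hA⟩ := exists_isResolventAt (T := T) (z := 0) (by rwa [subScalar_zero]) h.memBounded
    exact ⟨A, hA, hA.memCompact_iff.1 h⟩
  · rintro ⟨A, hA, hc⟩
    exact hA.memCompact_iff.2 hc

section Complete

variable [CompleteSpace H]

/-- A closed operator with `T - z` bounded below and of dense range has `z` in its resolvent
set. -/
theorem IsClosed.exists_isResolventAt_of_le {T : H →ₗ.[ℂ] H} (hT : T.IsClosed) {z : ℂ} {δ : ℝ}
    (hδ : 0 < δ) (hbd : ∀ x : T.domain, δ * ‖(x : H)‖ ≤ ‖T x - z • (x : H)‖)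
    (hdense : ∀ y, (∀ x : T.domain, ⟪T x - z • (x : H), y⟫ = 0) → y = 0) :
    ∃ R, T.IsResolventAt z R := by
  have hinj : Function.Injective (T.subScalar z) := by
    refine (LinearMap.ker_eq_bot (f := (T.subScalar z).toFun)).1 (LinearMap.ker_eq_bot'.2 ?_)
    intro x hx
    have h1 := hbd x
    have h2 : T x - z • (x : H) = 0 := hx
    rw [h2, norm_zero] at h1
    have h3 : ‖(x : H)‖ ≤ 0 := by
      by_contra hcon
      have := mul_pos hδ (not_le.1 hcon)
      linarith
    exact Subtype.ext (norm_le_zero_iff.1 h3)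
  have hrange : (LinearMap.range (T.subScalar z).toFun) = ⊤ := by
    have hcl : _root_.IsClosed (LinearMap.range (T.subScalar z).toFun : Set H) := by
      rw [← isSeqClosed_iff_isClosed]
      intro u b hu hub
      have hu' : ∀ n, ∃ x : T.domain, T x - z • (x : H) = u n := hu
      choose x hx' using hu'
      -- The lower bound makes preimages of a convergent sequence Cauchy; closedness of `T` then
      -- identifies the limit.
      have hcau : CauchySeq fun n => (x n : H) := by
        rw [Metric.cauchySeq_iff]
        intro ε hε
        obtain ⟨N, hN⟩ := Metric.cauchySeq_iff.1 hub.cauchySeq (δ * ε) (by positivity)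
        refine ⟨N, fun m hm n hn => ?_⟩
        have h1 := hN m hm n hn
        rw [dist_eq_norm] at h1 ⊢
        have h2 := hbd (x m - x n)
        have h3 : T (x m - x n) - z • ((x m - x n : T.domain) : H) = u m - u n := by
          rw [← hx' m, ← hx' n, LinearPMap.map_sub, Submodule.coe_sub, smul_sub]
          abel
        rw [h3, Submodule.coe_sub] at h2
        exact lt_of_mul_lt_mul_left (h2.trans_lt h1) hδ.le
      obtain ⟨a, ha⟩ := cauchySeq_tendsto_of_complete hcau
      have hb : Tendsto (fun n => T (x n)) atTop (𝓝 (b + z • a)) := by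
        have := hub.add (ha.const_smul z)
        refine this.congr fun n => ?_
        rw [← hx' n]
        abel
      obtain ⟨h, hh⟩ := hT.apply_of_tendsto ha hb
      refine ⟨⟨a, h⟩, ?_⟩
      change T ⟨a, h⟩ - z • a = b
      rw [hh]
      abel
    have hK : (LinearMap.range (T.subScalar z).toFun)ᗮ = ⊥ := by
      rw [Submodule.eq_bot_iff]
      intro y hy
      refine hdense y fun x => ?_
      exact (Submodule.mem_orthogonal _ _).1 hy _ ⟨x, rfl⟩
    have := hcl.completeSpace_coe
    rwa [Submodule.orthogonal_eq_bot_iff] at hK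
  refine exists_isResolventAt hinj ⟨by rw [resolventOp, inverse_domain, hrange], δ⁻¹, fun y => ?_⟩
  have hy : (y : H) ∈ LinearMap.range (T.subScalar z).toFun := hrange ▸ Submodule.mem_top
  obtain ⟨x, hx⟩ := hy
  have h : T.resolventOp z y = (x : H) :=
    inverse_apply_eq (f := T.subScalar z) (ker_eq_bot_of_injective hinj) (x := x) hx
  rw [h, inv_mul_eq_div, le_div_iff₀ hδ, mul_comm, ← hx]
  exact hbd x

end Complete

/-! ### Self-adjoint operators: maximality of the domain and points of the resolvent set -/

section SelfAdjoint

variable [CompleteSpace H] {T : H →ₗ.[ℂ] H}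

theorem inner_apply_comm (hself : IsSelfAdjoint T) (x y : T.domain) :
    ⟪T x, (y : H)⟫ = ⟪(x : H), T y⟫ := by
  have h := adjoint_isFormalAdjoint (T := T) hself.dense_domain
  have h' : T† = T := hself
  rw [h'] at h
  exact h x y

theorem mem_domain_of_inner (hself : IsSelfAdjoint T) {y w : H}
    (h : ∀ x : T.domain, ⟪w, (x : H)⟫ = ⟪y, T x⟫) : ∃ hy : y ∈ T.domain, T ⟨y, hy⟩ = w := by
  have h' : T† = T := hself
  have hy : y ∈ T†.domain := mem_adjoint_domain_of_exists y ⟨w, h⟩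
  have hw : T† ⟨y, hy⟩ = w := adjoint_apply_eq hself.dense_domain ⟨y, hy⟩ h
  -- Generalizing over `S` moves the value along `T† = T`, since the membership proof depends on the
  -- operator.
  have key : ∀ S : H →ₗ.[ℂ] H, T† = S → ∃ hy : y ∈ S.domain, S ⟨y, hy⟩ = w := by
    rintro S rfl
    exact ⟨hy, hw⟩
  exact key T h'

/-- Orthogonality to the range of `T - z` places `y` in the kernel of the adjoint. This reduces
density of the range to a statement about eigenvectors. -/
theorem eigenvector_of_orthogonal_range (hself : IsSelfAdjoint T) {z : ℂ} {y : H}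
    (h : ∀ x : T.domain, ⟪T x - z • (x : H), y⟫ = 0) :
    ∃ hy : y ∈ T.domain, T ⟨y, hy⟩ = (starRingEnd ℂ z) • y := by
  refine mem_domain_of_inner hself fun x => ?_
  have h1 := h x
  rw [inner_sub_left, inner_smul_left, sub_eq_zero] at h1
  rw [inner_smul_left, ← inner_conj_symm y (T x), h1, map_mul, inner_conj_symm]

/-- `i` belongs to the resolvent set of a self-adjoint operator. -/
theorem I_mem_resolventSet (hself : IsSelfAdjoint T) : Complex.I ∈ T.resolventSet := by
  rw [mem_resolventSet_iff]
  -- The cross term vanishes because `⟪T x, x⟫` is real. The case `s = 1` bounds `T - i` below; `s =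
  -- -1` rules out the eigenvalue `-i`, which gives dense range.
  have key : ∀ (s : ℝ) (x : T.domain),
      ‖T x - (s * Complex.I) • (x : H)‖ ^ 2 = ‖T x‖ ^ 2 + s ^ 2 * ‖(x : H)‖ ^ 2 := by
    intro s x
    rw [@norm_sub_sq ℂ, norm_smul]
    have h1 : (starRingEnd ℂ) ⟪T x, (x : H)⟫ = ⟪T x, (x : H)⟫ := by
      rw [inner_conj_symm, inner_apply_comm hself]
    have h2 : (⟪T x, (x : H)⟫).im = 0 := Complex.conj_eq_iff_im.1 h1
    have h3 : RCLike.re ⟪T x, ((s : ℂ) * Complex.I) • (x : H)⟫ = 0 := by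
      rw [inner_smul_right]
      simp [h2]
    rw [h3]
    simp [mul_pow]
  refine IsClosed.exists_isResolventAt_of_le hself.isClosed one_pos (fun x => ?_) fun y hy => ?_
  · have h := key 1 x
    simp only [Complex.ofReal_one, one_mul, one_pow] at h ⊢
    exact le_of_sq_le_sq (by nlinarith [sq_nonneg ‖T x‖]) (norm_nonneg _)
  · obtain ⟨hd, he⟩ := eigenvector_of_orthogonal_range hself hy
    have h := key (-1) ⟨y, hd⟩
    rw [he] at h
    simp only [Complex.conj_I, Complex.ofReal_neg, Complex.ofReal_one, neg_mul, one_mul, sub_self,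
      norm_zero] at h
    have h1 : ‖y‖ ^ 2 = 0 := by nlinarith [sq_nonneg ‖-Complex.I • y‖, sq_nonneg ‖y‖]
    exact norm_eq_zero.1 (pow_eq_zero_iff two_ne_zero |>.1 h1)

/-- An injective self-adjoint operator that is bounded below has a bounded inverse. -/
theorem exists_isResolventAt_zero (hself : IsSelfAdjoint T) (hinj : Function.Injective T) {δ : ℝ}
    (hδ : 0 < δ) (hbd : ∀ x : T.domain, δ * ‖(x : H)‖ ≤ ‖T x‖) : ∃ A, T.IsResolventAt 0 A := by
  refine IsClosed.exists_isResolventAt_of_le hself.isClosed hδ (by simpa using hbd) fun y hy => ?_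
  obtain ⟨hd, he⟩ := eigenvector_of_orthogonal_range hself hy
  have h : T ⟨y, hd⟩ = T 0 := by rw [he, LinearPMap.map_zero, RingHom.map_zero, zero_smul]
  exact congrArg Subtype.val (hinj h)

end SelfAdjoint

end LinearPMap

end

/-! ### Compact resolvents, the graph embedding and attained minima -/

section

namespace LinearPMap

variable {H : Type*} [NormedAddCommGroup H] [InnerProductSpace ℂ H] {T : H →ₗ.[ℂ] H}

local notation "⟪" x ", " y "⟫" => inner ℂ x y

/-- A consequence of the resolvent identity: compactness of `T⁻¹` passes to `(T - z)⁻¹`. -/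
theorem IsResolventAt.isCompactOperator {A R : H →L[ℂ] H} {z : ℂ} (hA : T.IsResolventAt 0 A)
    (hR : T.IsResolventAt z R) (hc : IsCompactOperator A) : IsCompactOperator R := by
  have h : R = (ContinuousLinearMap.id ℂ H + z • R).comp A := by
    ext y
    obtain ⟨hy, he⟩ := hA.1 y
    rw [zero_smul, sub_zero] at he
    have h1 := hR.2 ⟨A y, hy⟩
    rw [he] at h1
    -- Here `h1` reads `R (y - z • A y) = A y`.
    rw [_root_.map_sub, _root_.map_smul, sub_eq_iff_eq_add] at h1
    exact h1
  have h' := hc.clm_comp (ContinuousLinearMap.id ℂ H + z • R)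
  have e : (R : H → H) = (ContinuousLinearMap.id ℂ H + z • R) ∘ A :=
    funext fun y => congrArg (fun B : H →L[ℂ] H => B y) h
  rwa [e]

theorem GraphDomain.norm_embedding_le (x : T.GraphDomain) :
    ‖GraphDomain.embedding T x‖ ≤ ‖x‖ := by
  rw [GraphDomain.norm_eq]
  exact Real.le_sqrt_of_sq_le (by nlinarith [sq_nonneg ‖GraphDomain.op T x‖])

theorem GraphDomain.norm_op_le (x : T.GraphDomain) : ‖GraphDomain.op T x‖ ≤ ‖x‖ := by
  rw [GraphDomain.norm_eq]
  exact Real.le_sqrt_of_sq_le (by nlinarith [sq_nonneg ‖GraphDomain.embedding T x‖])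

/-- A compact resolvent makes the embedding of the graph domain compact. -/
theorem IsResolventAt.isCompactOperator_embedding {R : H →L[ℂ] H} {z : ℂ}
    (hR : T.IsResolventAt z R) (hc : IsCompactOperator R) :
    IsCompactOperator (GraphDomain.embedding T) := by
  let e : T.GraphDomain →L[ℂ] H := (GraphDomain.embedding T).mkContinuous 1
    fun x => by simpa using GraphDomain.norm_embedding_le x
  let o : T.GraphDomain →L[ℂ] H := (GraphDomain.op T).mkContinuous 1
    fun x => by simpa using GraphDomain.norm_op_le x
  have h := hc.comp_clm (o - z • e)
  have he : (GraphDomain.embedding T : T.GraphDomain → H) = R ∘ (o - z • e) :=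
    funext fun x => (hR.2 x).symm
  rwa [he]

theorem minModulus_le {S : H →ₗ.[ℂ] H} (x : S.domain) : S.minModulus * ‖(x : H)‖ ≤ ‖S x‖ := by
  have hb : BddBelow {r : ℝ | ∃ x : S.domain, ‖(x : H)‖ = 1 ∧ r = ‖S x‖} :=
    ⟨0, by rintro r ⟨x, -, rfl⟩; exact norm_nonneg _⟩
  by_cases hx : ‖(x : H)‖ = 0
  · rw [hx, mul_zero]
    exact norm_nonneg _
  · have h1 : S.minModulus ≤ ‖S (((‖(x : H)‖⁻¹ : ℝ) : ℂ) • x)‖ := by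
      refine csInf_le hb ⟨_, ?_, rfl⟩
      rw [Submodule.coe_smul, norm_smul]
      simp [hx]
    rw [LinearPMap.map_smul, norm_smul] at h1
    have h2 : 0 < ‖(x : H)‖ := lt_of_le_of_ne (norm_nonneg _) (Ne.symm hx)
    have h3 : ‖((‖(x : H)‖⁻¹ : ℝ) : ℂ)‖ = ‖(x : H)‖⁻¹ := by simp
    rw [h3, inv_mul_eq_div, le_div_iff₀ h2] at h1
    exact h1

theorem minModulus_nonneg (S : H →ₗ.[ℂ] H) : 0 ≤ S.minModulus :=
  Real.sInf_nonneg (by rintro r ⟨x, -, rfl⟩; exact norm_nonneg _)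

theorem exists_seq_tendsto_minModulus {S : H →ₗ.[ℂ] H} (hS : S.domain ≠ ⊥) :
    ∃ x : ℕ → S.domain, (∀ n, ‖(x n : H)‖ = 1) ∧
      Tendsto (fun n => ‖S (x n)‖) atTop (𝓝 S.minModulus) := by
  have hb : BddBelow {r : ℝ | ∃ x : S.domain, ‖(x : H)‖ = 1 ∧ r = ‖S x‖} :=
    ⟨0, by rintro r ⟨x, -, rfl⟩; exact norm_nonneg _⟩
  have hne : {r : ℝ | ∃ x : S.domain, ‖(x : H)‖ = 1 ∧ r = ‖S x‖}.Nonempty := by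
    obtain ⟨x, hx, hx0⟩ := Submodule.exists_mem_ne_zero_of_ne_bot hS
    refine ⟨_, ((‖x‖⁻¹ : ℝ) : ℂ) • ⟨x, hx⟩, ?_, rfl⟩
    rw [Submodule.coe_smul, norm_smul]
    simp [hx0]
  obtain ⟨u, -, hu, hmem⟩ := exists_seq_tendsto_sInf hne hb
  choose x hx1 hx2 using hmem
  exact ⟨x, hx1, hu.congr hx2⟩

section Complete

variable [CompleteSpace H]

/-- A closed operator with compactly embedded graph domain is absolutely minimum attaining. -/
theorem isAbsMinAttaining_of_isCompactOperator_embedding (hT : T.IsClosed)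
    (hc : IsCompactOperator (GraphDomain.embedding T)) : T.IsAbsMinAttaining := by
  intro M hM hne
  set S := T.domRestrict M with hS
  have hdom : S.domain = M ⊓ T.domain := rfl
  obtain ⟨x, hx1, hx2⟩ := exists_seq_tendsto_minModulus (S := S) (by rwa [hdom])
  let y : ℕ → T.domain := fun n => ⟨x n, (x n).2.2⟩
  have hSy : ∀ n, S (x n) = T (y n) := fun n => domRestrict_apply rfl
  set m := S.minModulus with hm
  obtain ⟨B, hB⟩ := hx2.isBoundedUnder_le.bddAbove_range
  obtain ⟨K, hK, hKs⟩ := IsCompactOperator.image_subset_compact_of_bounded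
    (f := GraphDomain.embedding T) hc (S := Set.range fun n => (y n : T.GraphDomain)) (by
      rw [isBounded_iff_forall_norm_le]
      refine ⟨Real.sqrt (1 ^ 2 + B ^ 2), ?_⟩
      rintro _ ⟨n, rfl⟩
      refine (GraphDomain.norm_eq T (y n)).trans_le ?_
      have h1 : ‖GraphDomain.embedding T (y n)‖ = 1 := hx1 n
      have h2 : ‖GraphDomain.op T (y n)‖ ≤ B := by
        refine le_trans (le_of_eq ?_) (hB ⟨n, rfl⟩)
        change ‖T (y n)‖ = ‖S (x n)‖
        rw [hSy]
      rw [h1]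
      gcongr)
  obtain ⟨a, -, φ, hφ, ha⟩ := hK.tendsto_subseq (x := fun n => (y n : H))
    (fun n => hKs ⟨y n, ⟨n, rfl⟩, rfl⟩)
  have hlim : Tendsto (fun n => ‖T (y (φ n))‖) atTop (𝓝 m) := by
    refine (hx2.comp hφ.tendsto_atTop).congr fun n => ?_
    simp only [Function.comp, hSy]
  have hna : ‖a‖ = 1 := by
    refine tendsto_nhds_unique ha.norm (tendsto_const_nhds.congr fun n => ?_)
    exact (hx1 (φ n)).symm
  -- The sum of two vectors of `M ∩ D(T)` stays there, so the minimum modulus bounds the other term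
  -- of the parallelogram law from below.
  have hpar : ∀ i j, ‖T (y i) - T (y j)‖ ^ 2 ≤
      2 * ‖T (y i)‖ ^ 2 + 2 * ‖T (y j)‖ ^ 2 - m ^ 2 * ‖(y i : H) + y j‖ ^ 2 := by
    intro i j
    have h1 := parallelogram_law_with_norm ℂ (T (y i)) (T (y j))
    have h2 : m * ‖(y i : H) + y j‖ ≤ ‖T (y i) + T (y j)‖ := by
      have := minModulus_le (S := S) (x i + x j)
      rw [LinearPMap.map_add, hSy, hSy] at this
      exact this
    have h3 := pow_le_pow_left₀ (mul_nonneg (minModulus_nonneg S) (norm_nonneg _)) h2 2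
    rw [mul_pow] at h3
    nlinarith
  have hcau : CauchySeq fun n => T (y (φ n)) := by
    have h0 : Tendsto (fun p : ℕ × ℕ => 2 * ‖T (y (φ p.1))‖ ^ 2 + 2 * ‖T (y (φ p.2))‖ ^ 2
        - m ^ 2 * ‖(y (φ p.1) : H) + y (φ p.2)‖ ^ 2) atTop (𝓝 0) := by
      rw [← prod_atTop_atTop_eq]
      have f1 : Tendsto (fun p : ℕ × ℕ => p.1) (atTop ×ˢ atTop) atTop := tendsto_fst
      have f2 : Tendsto (fun p : ℕ × ℕ => p.2) (atTop ×ˢ atTop) atTop := tendsto_snd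
      have h := ((((hlim.comp f1).pow 2).const_mul 2).add (((hlim.comp f2).pow 2).const_mul 2)).sub
        ((((ha.comp f1).add (ha.comp f2)).norm.pow 2).const_mul (m ^ 2))
      -- The bound in `hpar` tends to 0 because the limit `a` is still a unit vector.
      have e : 2 * m ^ 2 + 2 * m ^ 2 - m ^ 2 * ‖a + a‖ ^ 2 = 0 := by
        rw [← two_smul ℝ a, norm_smul, hna]
        norm_num
        ring
      rw [e] at h
      exact h
    rw [Metric.cauchySeq_iff']
    intro ε hε
    obtain ⟨⟨N1, N2⟩, hN⟩ := eventually_atTop.1 (h0.eventually (gt_mem_nhds (pow_pos hε 2)))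
    refine ⟨max N1 N2, fun n hn => ?_⟩
    have h1 := hN (n, max N1 N2) ⟨(le_max_left _ _).trans hn, le_max_right _ _⟩
    have h2 := (hpar (φ n) (φ (max N1 N2))).trans_lt h1
    rw [dist_eq_norm]
    exact lt_of_pow_lt_pow_left₀ 2 hε.le h2
  obtain ⟨b, hb⟩ := cauchySeq_tendsto_of_complete hcau
  obtain ⟨had, hTa⟩ := hT.apply_of_tendsto ha hb
  have haM : a ∈ M := hM.mem_of_tendsto ha (Eventually.of_forall fun n => (x (φ n)).2.1)
  have hSa : S ⟨a, haM, had⟩ = b := (domRestrict_apply (y := ⟨a, had⟩) rfl).trans hTa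
  refine ⟨⟨a, haM, had⟩, hna, ?_⟩
  refine (congrArg norm hSa).trans ?_
  exact tendsto_nhds_unique hb.norm hlim

end Complete

end LinearPMap

end

/-! ### From discrete spectrum to a compact inverse -/

section

local notation "⟪" x ", " y "⟫" => inner ℂ x y

variable {H : Type*} [NormedAddCommGroup H] [InnerProductSpace ℂ H]

theorem ContinuousLinearMap.isCompactOperator_of_range_subset {B : H →L[ℂ] H} {V : Submodule ℂ H}
    [FiniteDimensional ℂ V] (h : ∀ x, B x ∈ V) : IsCompactOperator B := by
  have : ProperSpace V := FiniteDimensional.proper ℂ V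
  exact (isCompactOperator_of_locallyCompactSpace_rng V.subtypeL).comp_clm (B.codRestrict V h)

section Complete

variable [CompleteSpace H]

/-- A self-adjoint operator whose spectrum away from zero consists of isolated eigenvalues of
finite multiplicity is compact. -/
theorem ContinuousLinearMap.isCompactOperator_of_finite_spectrum {A : H →L[ℂ] H}
    (hA : IsSelfAdjoint A) (hfin : ∀ ε > 0, {μ ∈ spectrum ℝ A | ε ≤ |μ|}.Finite)
    (hdim : ∀ μ ∈ spectrum ℝ A, μ ≠ 0 →
      FiniteDimensional ℂ (Module.End.eigenspace (A : Module.End ℂ H) (μ : ℂ))) :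
    IsCompactOperator A := by
  -- Away from 0 the spectrum is locally finite, so continuity only matters near 0, where `f`
  -- vanishes.
  have hcont : ∀ (δ : ℝ) (f : ℝ → ℝ), 0 < δ → (∀ x, |x| < δ → f x = 0) →
      ContinuousOn f (spectrum ℝ A) := by
    intro δ f hδ hf x hx
    by_cases hxδ : |x| < δ
    · refine ContinuousAt.continuousWithinAt ?_
      have hn : ∀ᶠ y in 𝓝 x, f y = 0 := by
        filter_upwards [continuous_abs.continuousAt.eventually_lt continuousAt_const hxδ] with y hy
        exact hf y hy
      exact (continuousAt_const (y := (0 : ℝ))).congr (hn.mono fun y hy => hy.symm)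
    · have hU : {y : ℝ | δ / 2 ≤ |y|} ∈ 𝓝 x := by
        have : δ / 2 < |x| := by linarith
        filter_upwards [continuousAt_const.eventually_lt continuous_abs.continuousAt this] with y hy
        exact le_of_lt hy
      rw [← continuousWithinAt_inter hU]
      exact (hfin (δ / 2) (by positivity)).continuousOn f x ⟨hx, show δ / 2 ≤ |x| by linarith⟩
  refine isClosed_setOfPred_isCompactOperator.closure_subset (Metric.mem_closure_iff.2 ?_)
  intro ε hε
  obtain ⟨δ, hδ, hδε⟩ := exists_between hε
  set S := (hfin δ hδ).toFinset with hS
  -- `cfc (h μ) A` is `μ` times the spectral projection at `μ`. On the spectrum, the sum over `S`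
  -- equals the identity where `δ ≤ |x|` and 0 elsewhere, so it misses the identity by at most `δ`.
  let h : ℝ → ℝ → ℝ := fun μ x => if x = μ then μ else 0
  have hhc : ∀ μ ∈ S, ContinuousOn (h μ) (spectrum ℝ A) := by
    intro μ hμ
    rw [hS, Set.Finite.mem_toFinset] at hμ
    refine hcont δ _ hδ fun x hx => if_neg ?_
    rintro rfl
    exact absurd hx (not_lt.2 hμ.2)
  refine ⟨cfc (∑ μ ∈ S, h μ) A, ?_, ?_⟩
  · rw [cfc_sum h A S hhc]
    refine Submodule.sum_mem (compactOperator (RingHom.id ℂ) H H) fun μ hμ => ?_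
    have hμ' := hμ
    rw [hS, Set.Finite.mem_toFinset] at hμ'
    have hμ0 : μ ≠ 0 := by
      rintro rfl
      simp only [Set.mem_ofPred_eq, abs_zero] at hμ'
      linarith [hμ'.2]
    have := hdim μ hμ'.1 hμ0
    refine isCompactOperator_of_range_subset
      (V := Module.End.eigenspace (A : Module.End ℂ H) (μ : ℂ)) fun x => ?_
    rw [Module.End.mem_eigenspace_iff]
    have e1 : A * cfc (h μ) A = μ • cfc (h μ) A := by
      nth_rewrite 1 [← cfc_id ℝ A]
      rw [← cfc_mul id (h μ) A continuousOn_id (hhc μ hμ), ← cfc_const_mul μ (h μ) A (hhc μ hμ)]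
      congr 1
      ext y
      by_cases hy : y = μ
      · simp [h, hy]
      · simp [h, hy]
    have e2 := congrArg (fun B : H →L[ℂ] H => B x) e1
    simp only [mul_apply_eq_comp, _root_.smul_apply] at e2
    exact e2.trans (RCLike.real_smul_eq_coe_smul (K := ℂ) _ _)
  · have hsc : ContinuousOn (∑ μ ∈ S, h μ) (spectrum ℝ A) := by
      refine hcont δ _ hδ fun x hx => ?_
      rw [Finset.sum_apply]
      refine Finset.sum_eq_zero fun μ hμ => if_neg ?_
      rintro rfl
      rw [hS, Set.Finite.mem_toFinset] at hμ
      exact absurd hx (not_lt.2 hμ.2)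
    rw [dist_eq_norm]
    refine lt_of_le_of_lt ?_ hδε
    nth_rewrite 1 [← cfc_id ℝ A]
    rw [← cfc_sub id (∑ μ ∈ S, h μ) A continuousOn_id hsc]
    refine norm_cfc_le hδ.le fun x hx => ?_
    rw [Finset.sum_apply, Real.norm_eq_abs]
    simp only [h, Finset.sum_ite_eq, id]
    split_ifs with hxS
    · simpa using hδ.le
    · rw [hS, Set.Finite.mem_toFinset] at hxS
      rw [sub_zero]
      by_contra hcon
      exact hxS ⟨hx, (not_le.1 hcon).le⟩

end Complete

namespace LinearPMap

variable {T : H →ₗ.[ℂ] H}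

theorem IsResolventAt.mem_domain {A : H →L[ℂ] H} (hA : T.IsResolventAt 0 A) (y : H) :
    A y ∈ T.domain := (hA.1 y).1

theorem IsResolventAt.apply_inverse {A : H →L[ℂ] H} (hA : T.IsResolventAt 0 A) (y : H) :
    T ⟨A y, hA.mem_domain y⟩ = y := by
  have h := (hA.1 y).2
  rwa [zero_smul, sub_zero] at h

theorem IsResolventAt.inverse_apply {A : H →L[ℂ] H} (hA : T.IsResolventAt 0 A) (x : T.domain) :
    A (T x) = x := by
  have h := hA.2 x
  rwa [zero_smul, sub_zero] at h

theorem IsResolventAt.inverse_injective {A : H →L[ℂ] H} (hA : T.IsResolventAt 0 A) :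
    Function.Injective A := by
  intro x y hxy
  have h : (⟨A x, hA.mem_domain x⟩ : T.domain) = ⟨A y, hA.mem_domain y⟩ := Subtype.ext hxy
  rw [← hA.apply_inverse x, h, hA.apply_inverse y]

section Complete

variable [CompleteSpace H]

theorem IsResolventAt.isSymmetric {A : H →L[ℂ] H} (hself : IsSelfAdjoint T)
    (hA : T.IsResolventAt 0 A) : (A : H →ₗ[ℂ] H).IsSymmetric := by
  intro x y
  have h := inner_apply_comm hself ⟨A x, hA.mem_domain x⟩ ⟨A y, hA.mem_domain y⟩
  rw [hA.apply_inverse, hA.apply_inverse] at h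
  exact h.symm

/-- Nonzero spectral values of `T⁻¹` are inverses of spectral values of `T`. -/
theorem IsResolventAt.inv_mem_spectrumSet {A : H →L[ℂ] H} (hA : T.IsResolventAt 0 A) {μ : ℂ}
    (hμ0 : μ ≠ 0) (hμ : μ ∈ spectrum ℂ A) : μ⁻¹ ∈ T.spectrumSet := by
  intro hmem
  obtain ⟨R, hR⟩ := mem_resolventSet_iff.1 hmem
  apply hμ
  -- `μ - A = μ (T - μ⁻¹) A` is a composition of bijections if `μ⁻¹` is in the resolvent set.
  have key : ∀ y, (algebraMap ℂ (H →L[ℂ] H) μ - A) y =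
      μ • (T ⟨A y, hA.mem_domain y⟩ - μ⁻¹ • A y) := by
    intro y
    rw [hA.apply_inverse, smul_sub, smul_smul, mul_inv_cancel₀ hμ0, one_smul]
    rw [_root_.sub_apply, Algebra.algebraMap_eq_smul_one]
    rfl
  refine ContinuousLinearMap.isUnit_iff_bijective.2 ⟨?_, ?_⟩
  · intro x y hxy
    rw [key, key] at hxy
    have h1 := smul_right_injective H hμ0 hxy
    have h2 := congrArg R h1
    have hx := hR.2 ⟨A x, hA.mem_domain x⟩
    have hy := hR.2 ⟨A y, hA.mem_domain y⟩
    exact hA.inverse_injective (hx.symm.trans (h2.trans hy))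
  · intro w
    obtain ⟨hd, he⟩ := hR.1 (μ⁻¹ • w)
    refine ⟨T ⟨R (μ⁻¹ • w), hd⟩, ?_⟩
    have h1 : (⟨A (T ⟨R (μ⁻¹ • w), hd⟩), hA.mem_domain _⟩ : T.domain) = ⟨R (μ⁻¹ • w), hd⟩ :=
      Subtype.ext (hA.inverse_apply _)
    rw [key, h1, hA.inverse_apply, he, smul_smul, mul_inv_cancel₀ hμ0, one_smul]

/-- Purely discrete spectrum forces the inverse to be compact. -/
theorem HasPurelyDiscreteSpectrum.exists_compact_inverse (hself : IsSelfAdjoint T)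
    (hinj : Function.Injective T) (hd : T.HasPurelyDiscreteSpectrum) :
    ∃ A, T.IsResolventAt 0 A ∧ IsCompactOperator A := by
  have h0 : (0 : ℂ) ∈ T.resolventSet := by
    by_contra hcon
    refine (hd.1 0 hcon).1 ?_
    rw [Submodule.eq_bot_iff]
    intro x hx
    rw [mem_eigenspaceAt_iff, zero_smul] at hx
    exact hinj (hx.trans T.map_zero.symm)
  obtain ⟨A, hA⟩ := mem_resolventSet_iff.1 h0
  have hsymm := hA.isSymmetric hself
  have hspec : ∀ μ : ℝ, μ ≠ 0 → μ ∈ spectrum ℝ A → ((μ : ℂ))⁻¹ ∈ T.spectrumSet := by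
    intro μ hμ0 hμ
    refine hA.inv_mem_spectrumSet (by exact_mod_cast hμ0) ?_
    exact spectrum.algebraMap_mem (S := ℂ) hμ
  refine ⟨A, hA, ContinuousLinearMap.isCompactOperator_of_finite_spectrum
    (ContinuousLinearMap.isSelfAdjoint_iff_isSymmetric.2 hsymm) ?_ ?_⟩
  · intro ε hε
    by_contra hinf
    -- The inverses would be infinitely many spectral points of `T` in the compact ball of radius
    -- `ε⁻¹`, hence would accumulate.
    have hinf' : ((fun μ : ℝ => ((μ : ℂ))⁻¹) '' {μ ∈ spectrum ℝ A | ε ≤ |μ|}).Infinite := by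
      refine Set.Infinite.image (fun a _ b _ hab => ?_) hinf
      exact_mod_cast inv_injective hab
    obtain ⟨z, -, hz⟩ := hinf'.exists_accPt_of_subset_isCompact
      (isCompact_closedBall (0 : ℂ) ε⁻¹) (by
        rintro _ ⟨μ, hμ, rfl⟩
        rw [mem_closedBall_zero_iff, norm_inv, Complex.norm_real, Real.norm_eq_abs]
        exact inv_anti₀ hε hμ.2)
    refine hd.2 z (hz.mono (principal_mono.2 ?_))
    rintro _ ⟨μ, hμ, rfl⟩
    refine hspec μ ?_ hμ.1
    rintro rfl
    have := hμ.2
    rw [abs_zero] at this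
    linarith
  · intro μ hμ hμ0
    have hμc : (μ : ℂ) ≠ 0 := by exact_mod_cast hμ0
    have := (hd.1 _ (hspec μ hμ0 hμ)).2
    let L : T.eigenspaceAt (μ : ℂ)⁻¹ →ₗ[ℂ] H := T.domain.subtype ∘ₗ Submodule.subtype _
    refine Submodule.finiteDimensional_of_le (S₂ := LinearMap.range L) ?_
    intro y hy
    rw [Module.End.mem_eigenspace_iff] at hy
    have hy' : A y = (μ : ℂ) • y := hy
    have hyd : y ∈ T.domain := by
      have h1 : y = (μ : ℂ)⁻¹ • A y := by rw [hy', smul_smul, inv_mul_cancel₀ hμc, one_smul]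
      rw [h1]
      exact T.domain.smul_mem _ (hA.mem_domain y)
    refine ⟨⟨⟨y, hyd⟩, ?_⟩, rfl⟩
    rw [mem_eigenspaceAt_iff, ← sub_eq_zero]
    have h2 : A (T ⟨y, hyd⟩ - (μ : ℂ)⁻¹ • y) = 0 := by
      rw [_root_.map_sub, hA.inverse_apply, _root_.map_smul, hy', smul_smul, inv_mul_cancel₀ hμc, one_smul,
        sub_self]
    exact hA.inverse_injective (h2.trans (_root_.map_zero A).symm)

end Complete

end LinearPMap

end

/-! ### Orthonormal eigenbases and discreteness of the spectrum -/

section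

local notation "⟪" x ", " y "⟫" => inner ℂ x y

variable {H : Type*} [NormedAddCommGroup H] [InnerProductSpace ℂ H]

/-- A compact operator has only finitely many eigenvalues away from zero along an orthonormal
family of eigenvectors. -/
theorem IsCompactOperator.finite_le_norm_eigenvalue {A : H →L[ℂ] H} (hc : IsCompactOperator A)
    {ι : Type*} {v : ι → H} (hv : Orthonormal ℂ v) {μ : ι → ℂ} (hμ : ∀ i, A (v i) = μ i • v i)
    {ε : ℝ} (hε : 0 < ε) : {i | ε ≤ ‖μ i‖}.Finite := by
  by_contra hinf
  let f := Set.Infinite.natEmbedding _ hinf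
  obtain ⟨K, hK, hKs⟩ := IsCompactOperator.image_closedBall_subset_compact
    (f := (A : H →ₗ[ℂ] H)) hc 1
  obtain ⟨a, -, φ, hφ, ha⟩ := hK.tendsto_subseq (x := fun n => A (v (f n)))
    (fun n => hKs ⟨v (f n), by simp [hv.1], rfl⟩)
  obtain ⟨N, hN⟩ := Metric.cauchySeq_iff'.1 ha.cauchySeq ε hε
  have h := hN (N + 1) (Nat.le_succ N)
  have hne : (f (φ (N + 1)) : ι) ≠ f (φ N) := by
    intro he
    have := hφ.injective (f.injective (Subtype.ext he))
    omega
  simp only [Function.comp, dist_eq_norm, hμ] at h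
  have h1 : ⟪μ (f (φ (N + 1))) • v (f (φ (N + 1))), μ (f (φ N)) • v (f (φ N))⟫ = 0 := by
    rw [inner_smul_left, inner_smul_right, hv.2 hne, mul_zero, mul_zero]
  -- By orthogonality the squared distance is `|μ|² + |μ'|² ≥ ε²`, so no subsequence of the images
  -- is Cauchy.
  have h2 := norm_sub_sq (𝕜 := ℂ) (μ (f (φ (N + 1))) • v (f (φ (N + 1))))
    (μ (f (φ N)) • v (f (φ N)))
  rw [h1, map_zero, mul_zero, sub_zero, norm_smul, norm_smul, hv.1, hv.1, mul_one, mul_one] at h2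
  have h3 : ε ≤ ‖μ (f (φ (N + 1)))‖ := (f (φ (N + 1))).2
  have h4 := pow_lt_pow_left₀ h (norm_nonneg _) two_ne_zero
  have h5 := pow_le_pow_left₀ hε.le h3 2
  linarith [sq_nonneg ‖μ (f (φ N))‖]

namespace LinearPMap

theorem not_finiteDimensional_of_not_isBoundedOp {T : H →ₗ.[ℂ] H} (hunb : ¬ T.IsBoundedOp) :
    ¬ FiniteDimensional ℂ H := by
  intro hfin
  apply hunb
  let L : T.domain →L[ℂ] H := LinearMap.toContinuousLinearMap T.toFun
  exact ⟨‖L‖, fun x => L.le_opNorm x⟩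

end LinearPMap

/-- Parseval's identity, used to pass from coordinatewise bounds on `T - z` to norm bounds. -/
theorem HilbertBasis.hasSum_norm_sq_inner (v : HilbertBasis ℕ ℂ H) (x : H) :
    HasSum (fun n => ‖⟪v n, x⟫‖ ^ 2) (‖x‖ ^ 2) := by
  have h := v.hasSum_inner_mul_inner x x
  rw [inner_self_eq_norm_sq_to_K] at h
  have e : ∀ n, ⟪x, v n⟫ * ⟪v n, x⟫ = ((‖⟪v n, x⟫‖ ^ 2 : ℝ) : ℂ) := by
    intro n
    rw [← inner_conj_symm x, Complex.conj_mul']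
    push_cast
    rfl
  simp_rw [e] at h
  have h' : HasSum (fun n => ((‖⟪v n, x⟫‖ ^ 2 : ℝ) : ℂ)) ((‖x‖ ^ 2 : ℝ) : ℂ) := by
    rw [Complex.ofReal_pow]
    exact h
  exact Complex.hasSum_ofReal.1 h'

section Complete

variable [CompleteSpace H]

/-- **Spectral theorem**: an injective compact self-adjoint operator on an infinite-dimensional
Hilbert space is diagonal in some orthonormal basis indexed by `ℕ`. -/
theorem IsCompactOperator.exists_hilbertBasis_eigenvectors {A : H →L[ℂ] H}
    (hc : IsCompactOperator A) (hA : (A : H →ₗ[ℂ] H).IsSymmetric) (hinj : Function.Injective A)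
    (hdim : ¬ FiniteDimensional ℂ H) :
    ∃ (v : HilbertBasis ℕ ℂ H) (μ : ℕ → ℂ), ∀ n, A (v n) = μ n • v n := by
  let E : ℂ → Submodule ℂ H := fun μ => Module.End.eigenspace (A : Module.End ℂ H) μ
  have hE : ∀ μ x, x ∈ E μ ↔ A x = μ • x := fun μ x => Module.End.mem_eigenspace_iff
  have hfin : ∀ μ, FiniteDimensional ℂ (E μ) := by
    intro μ
    by_cases h : μ = 0
    · have : E μ = ⊥ := by
        rw [Submodule.eq_bot_iff]
        intro x hx
        rw [hE, h, zero_smul] at hx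
        exact hinj (hx.trans (map_zero A).symm)
      rw [this]
      infer_instance
    · exact ContinuousLinearMap.finite_dimensional_eigenspace hc μ h
  let b : ∀ μ, OrthonormalBasis (Fin (Module.finrank ℂ (E μ))) ℂ (E μ) :=
    fun μ => stdOrthonormalBasis ℂ (E μ)
  -- The index runs over all complex `μ`; fibres over non-eigenvalues are empty.
  let w : (Σ μ : ℂ, Fin (Module.finrank ℂ (E μ))) → H := fun i => b i.1 i.2
  have hw : Orthonormal ℂ w :=
    hA.orthogonalFamily_eigenspaces.orthonormal_sigma_orthonormal (v_family := fun μ => b μ)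
      fun μ => (b μ).orthonormal
  have hAw : ∀ i, A (w i) = i.1 • w i := fun i => (hE _ _).1 (b i.1 i.2).2
  have hspan : (Submodule.span ℂ (Set.range w))ᗮ = ⊥ := by
    have hle : (⨆ μ, E μ) ≤ Submodule.span ℂ (Set.range w) := by
      refine iSup_le fun μ x hx => ?_
      have h := congrArg Subtype.val ((b μ).sum_repr ⟨x, hx⟩)
      simp only [Submodule.coe_sum, Submodule.coe_smul] at h
      rw [← h]
      exact Submodule.sum_mem _ fun i _ =>
        Submodule.smul_mem _ _ (Submodule.subset_span ⟨⟨μ, i⟩, rfl⟩)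
    rw [eq_bot_iff]
    refine (Submodule.orthogonal_le hle).trans (le_of_eq ?_)
    exact ContinuousLinearMap.orthogonalComplement_iSup_eigenspaces_eq_bot hc hA
  have hμ0 : ∀ i : Σ μ : ℂ, Fin (Module.finrank ℂ (E μ)), i.1 ≠ 0 := by
    intro i h0
    have h1 := hAw i
    rw [h0, zero_smul] at h1
    have h2 := hinj (h1.trans (map_zero A).symm)
    exact hw.ne_zero i h2
  have hcount : Countable (Σ μ : ℂ, Fin (Module.finrank ℂ (E μ))) := by
    rw [← Set.countable_univ_iff]
    have : (Set.univ : Set (Σ μ : ℂ, Fin (Module.finrank ℂ (E μ)))) ⊆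
        ⋃ n : ℕ, {i | 1 / ((n : ℝ) + 1) ≤ ‖i.1‖} := by
      intro i _
      obtain ⟨n, hn⟩ := exists_nat_one_div_lt (norm_pos_iff.2 (hμ0 i))
      exact Set.mem_iUnion.2 ⟨n, hn.le⟩
    refine Set.Countable.mono this (Set.countable_iUnion fun n => ?_)
    exact (hc.finite_le_norm_eigenvalue hw hAw (by positivity)).countable
  have hinf : Infinite (Σ μ : ℂ, Fin (Module.finrank ℂ (E μ))) := by
    by_contra hcon
    have hF : Finite (Σ μ : ℂ, Fin (Module.finrank ℂ (E μ))) := not_infinite_iff_finite.1 hcon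
    have := Fintype.ofFinite (Σ μ : ℂ, Fin (Module.finrank ℂ (E μ)))
    exact hdim (Module.Basis.finiteDimensional_of_finite
      ((HilbertBasis.mkOfOrthogonalEqBot hw hspan).toOrthonormalBasis).toBasis)
  obtain ⟨_⟩ := nonempty_denumerable (Σ μ : ℂ, Fin (Module.finrank ℂ (E μ)))
  let e := Denumerable.eqv (Σ μ : ℂ, Fin (Module.finrank ℂ (E μ)))
  have hw' : Orthonormal ℂ (w ∘ e.symm) := hw.comp _ e.symm.injective
  refine ⟨HilbertBasis.mkOfOrthogonalEqBot hw' (by rwa [EquivLike.range_comp]),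
    fun n => (e.symm n).1, fun n => ?_⟩
  rw [HilbertBasis.coe_mkOfOrthogonalEqBot]
  exact hAw _

namespace LinearPMap

variable {T : H →ₗ.[ℂ] H}

/-- Compactness of the inverse yields an orthonormal basis of eigenvectors of `T` with
eigenvalues tending to infinity. -/
theorem IsResolventAt.exists_hilbertBasis {A : H →L[ℂ] H} (hA : T.IsResolventAt 0 A)
    (hself : IsSelfAdjoint T) (hunb : ¬ T.IsBoundedOp) (hc : IsCompactOperator A) :
    ∃ (lam : ℕ → ℝ) (v : HilbertBasis ℕ ℂ H),
      Tendsto (fun n => |lam n|) atTop atTop ∧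
        ∀ n, ∃ hn : v n ∈ T.domain, T ⟨v n, hn⟩ = (lam n : ℂ) • v n := by
  have hsymm := hA.isSymmetric hself
  obtain ⟨v, μ, hv⟩ := hc.exists_hilbertBasis_eigenvectors hsymm hA.inverse_injective
    (not_finiteDimensional_of_not_isBoundedOp hunb)
  have hv0 : ∀ n, v n ≠ 0 := fun n => v.orthonormal.ne_zero n
  have hμ0 : ∀ n, μ n ≠ 0 := by
    intro n h0
    have h1 := hv n
    rw [h0, zero_smul] at h1
    exact hv0 n (hA.inverse_injective (h1.trans (_root_.map_zero A).symm))
  have hreal : ∀ n, ((μ n).re : ℂ) = μ n := by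
    intro n
    refine Complex.conj_eq_iff_re.1 (hsymm.conj_eigenvalue_eq_self (μ := μ n) ?_)
    exact Module.End.hasEigenvalue_of_hasEigenvector (x := v n)
      ⟨Module.End.mem_eigenspace_iff.2 (hv n), hv0 n⟩
  refine ⟨fun n => (μ n).re⁻¹, v, ?_, fun n => ?_⟩
  · rw [← Nat.cofinite_eq_atTop, tendsto_atTop]
    intro B
    have hfin := hc.finite_le_norm_eigenvalue v.orthonormal hv (ε := (|B| + 1)⁻¹) (by positivity)
    filter_upwards [hfin.compl_mem_cofinite] with n hn
    have h1 : ‖μ n‖ < (|B| + 1)⁻¹ := not_le.1 hn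
    have h2 : |(μ n).re| = ‖μ n‖ := by
      rw [← Real.norm_eq_abs, ← Complex.norm_real, hreal]
    have h3 : 0 < ‖μ n‖ := norm_pos_iff.2 (hμ0 n)
    rw [abs_inv, h2]
    have h4 := (lt_inv_comm₀ h3 (by positivity)).1 h1
    linarith [le_abs_self B]
  · have h1 : A ((μ n)⁻¹ • v n) = v n := by
      rw [_root_.map_smul, hv, smul_smul, inv_mul_cancel₀ (hμ0 n), one_smul]
    have hd : v n ∈ T.domain := h1 ▸ hA.mem_domain _
    refine ⟨hd, ?_⟩
    have h2 : (⟨A ((μ n)⁻¹ • v n), hA.mem_domain _⟩ : T.domain) = ⟨v n, hd⟩ := Subtype.ext h1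
    rw [← h2, hA.apply_inverse, Complex.ofReal_inv, hreal]

/-- A self-adjoint operator diagonal in an orthonormal basis, with eigenvalues tending to infinity,
has purely discrete spectrum. -/
theorem hasPurelyDiscreteSpectrum_of_hilbertBasis (hself : IsSelfAdjoint T) {lam : ℕ → ℝ}
    (v : HilbertBasis ℕ ℂ H) (hlam : Tendsto (fun n => |lam n|) atTop atTop)
    (hv : ∀ n, ∃ hn : v n ∈ T.domain, T ⟨v n, hn⟩ = (lam n : ℂ) • v n) :
    T.HasPurelyDiscreteSpectrum := by
  have hcoord : ∀ (x : T.domain) n, ⟪v n, T x⟫ = lam n * ⟪v n, (x : H)⟫ := by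
    intro x n
    obtain ⟨hn, he⟩ := hv n
    have h := inner_apply_comm hself ⟨v n, hn⟩ x
    rw [he, inner_smul_left, Complex.conj_ofReal] at h
    exact h.symm
  have htend : ∀ z : ℂ, Tendsto (fun n => ‖(lam n : ℂ) - z‖) cofinite atTop := by
    intro z
    rw [Nat.cofinite_eq_atTop]
    refine tendsto_atTop_mono (f := fun n => |lam n| - ‖z‖) (fun n => ?_)
      (tendsto_atTop_add_const_right _ _ hlam)
    have h := norm_sub_norm_le (lam n : ℂ) z
    rwa [Complex.norm_real, Real.norm_eq_abs] at h
  have hlt : ∀ (z : ℂ) (B : ℝ), {n | ‖(lam n : ℂ) - z‖ < B}.Finite := by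
    intro z B
    have h := (htend z).eventually_ge_atTop B
    refine (eventually_cofinite.1 h).subset fun n hn => not_le.2 hn
  have hspec : ∀ z ∈ T.spectrumSet, ∃ n, (lam n : ℂ) = z := by
    intro z hz
    by_contra! hcon
    -- Since `|lam n - z|` tends to infinity it attains its minimum `δ`, which bounds `T - z` below.
    obtain ⟨n₀, hn₀⟩ := (htend z).exists_forall_le
    set δ := ‖(lam n₀ : ℂ) - z‖ with hδ
    have hδ0 : 0 < δ := norm_pos_iff.2 (sub_ne_zero.2 (hcon n₀))
    refine hz (mem_resolventSet_iff.2 (IsClosed.exists_isResolventAt_of_le hself.isClosed hδ0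
      (fun x => ?_) fun y hy => ?_))
    · refine le_of_sq_le_sq ?_ (norm_nonneg _)
      rw [mul_pow]
      refine hasSum_le (fun n => ?_) ((v.hasSum_norm_sq_inner x).mul_left (δ ^ 2))
        (v.hasSum_norm_sq_inner (T x - z • (x : H)))
      rw [inner_sub_right, inner_smul_right, hcoord, ← sub_mul, norm_mul, mul_pow]
      exact mul_le_mul_of_nonneg_right (pow_le_pow_left₀ hδ0.le (hn₀ n) 2) (sq_nonneg _)
    · have h0 : ∀ n, ⟪v n, y⟫ = 0 := by
        intro n
        obtain ⟨hn, he⟩ := hv n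
        have h := hy ⟨v n, hn⟩
        rw [he, ← sub_smul, inner_smul_left, mul_eq_zero] at h
        exact h.resolve_left ((map_ne_zero _).2 (sub_ne_zero.2 (hcon n)))
      have h := v.hasSum_norm_sq_inner y
      simp only [h0, norm_zero, ne_eq, OfNat.ofNat_ne_zero, not_false_eq_true, zero_pow] at h
      exact norm_eq_zero.1 ((pow_eq_zero_iff two_ne_zero).1 (h.unique hasSum_zero))
  refine ⟨fun z hz => ⟨?_, ?_⟩, fun z hz => ?_⟩
  · obtain ⟨n, rfl⟩ := hspec z hz
    obtain ⟨hn, he⟩ := hv n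
    rw [Submodule.ne_bot_iff]
    refine ⟨⟨v n, hn⟩, mem_eigenspaceAt_iff.2 he, fun h => v.orthonormal.ne_zero n ?_⟩
    exact congrArg Subtype.val h
  · have hF : Finite {n | (lam n : ℂ) = z} := by
      refine (hlt z 1).subset fun n (hn : (lam n : ℂ) = z) => ?_
      change ‖(lam n : ℂ) - z‖ < 1
      rw [hn, sub_self, norm_zero]
      exact one_pos
    -- An eigenvector at `z` is determined by its finitely many coordinates with `lam n = z`; the
    -- others vanish.
    let L : T.eigenspaceAt z →ₗ[ℂ] ({n | (lam n : ℂ) = z} → ℂ) :=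
      LinearMap.pi fun n => (innerₛₗ ℂ (v n)) ∘ₗ T.domain.subtype ∘ₗ Submodule.subtype _
    refine FiniteDimensional.of_injective L (LinearMap.ker_eq_bot.1 (LinearMap.ker_eq_bot'.2 ?_))
    rintro ⟨x, hx⟩ hLx
    rw [mem_eigenspaceAt_iff] at hx
    have h0 : ∀ n, ⟪v n, (x : H)⟫ = 0 := by
      intro n
      by_cases hn : (lam n : ℂ) = z
      · exact congrFun hLx ⟨n, hn⟩
      · have h := hcoord x n
        rw [hx, inner_smul_right] at h
        have h' : ((lam n : ℂ) - z) * ⟪v n, (x : H)⟫ = 0 := by rw [sub_mul, h, sub_self]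
        exact (mul_eq_zero.1 h').resolve_left (sub_ne_zero.2 hn)
    have h := v.hasSum_norm_sq_inner (x : H)
    simp only [h0, norm_zero, ne_eq, OfNat.ofNat_ne_zero, not_false_eq_true, zero_pow] at h
    exact Subtype.ext (Subtype.ext
      (norm_eq_zero.1 ((pow_eq_zero_iff two_ne_zero).1 (h.unique hasSum_zero))))
  · have h := hz.nhds_inter (Metric.ball_mem_nhds z one_pos)
    refine Set.Infinite.of_accPt h (((hlt z 1).image fun n => (lam n : ℂ)).subset ?_)
    rintro w ⟨hw1, hw2⟩
    obtain ⟨n, rfl⟩ := hspec w hw2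
    exact ⟨n, by simpa [dist_eq_norm] using hw1, rfl⟩

end LinearPMap

end Complete

end

/-! ### From absolute minimum attainment to a compact inverse -/

section

local notation "⟪" x ", " y "⟫" => inner ℂ x y

variable {H : Type*} [NormedAddCommGroup H] [InnerProductSpace ℂ H]

/-- Pythagoras for finite sums over an orthogonal family. -/
theorem norm_sq_sum_smul_of_pairwise {ι : Type*} {u : ι → H}
    (hu : Pairwise fun i j => ⟪u i, u j⟫ = 0) (a : ι → ℂ) (s : Finset ι) :
    ‖∑ i ∈ s, a i • u i‖ ^ 2 = ∑ i ∈ s, ‖a i‖ ^ 2 * ‖u i‖ ^ 2 := by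
  classical
  induction s using Finset.induction_on with
  | empty => simp
  | insert j s hj ih =>
    have h0 : ⟪a j • u j, ∑ i ∈ s, a i • u i⟫ = 0 := by
      rw [inner_sum]
      refine Finset.sum_eq_zero fun i hi => ?_
      rw [inner_smul_left, inner_smul_right, hu (ne_of_mem_of_not_mem hi hj).symm, mul_zero,
        mul_zero]
    rw [Finset.sum_insert hj, Finset.sum_insert hj, ← ih, @norm_add_sq ℂ, h0, norm_smul, mul_pow]
    simp

/-- A linear image of an orthonormal family that stays orthogonal: the operator norm bounds on the
family extend to its closed span. -/
theorem norm_le_of_mem_closure_span {A : H →L[ℂ] H} {y : ℕ → H} (hy : Orthonormal ℂ y)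
    (hAy : Pairwise fun i j => ⟪A (y i), A (y j)⟫ = 0) {c d : ℝ} (hc : 0 ≤ c) (hd : 0 ≤ d)
    (hcy : ∀ n, c ≤ ‖A (y n)‖) (hdy : ∀ n, ‖A (y n)‖ ≤ d) {z : H}
    (hz : z ∈ (Submodule.span ℂ (Set.range y)).topologicalClosure) :
    c * ‖z‖ ≤ ‖A z‖ ∧ ‖A z‖ ≤ d * ‖z‖ := by
  have hcl : IsClosed {z : H | c * ‖z‖ ≤ ‖A z‖ ∧ ‖A z‖ ≤ d * ‖z‖} := by
    have h1 : IsClosed {z : H | c * ‖z‖ ≤ ‖A z‖} := isClosed_le (by fun_prop) (by fun_prop)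
    have h2 : IsClosed {z : H | ‖A z‖ ≤ d * ‖z‖} := isClosed_le (by fun_prop) (by fun_prop)
    exact h1.inter h2
  refine closure_minimal (t := {z : H | c * ‖z‖ ≤ ‖A z‖ ∧ ‖A z‖ ≤ d * ‖z‖}) ?_ hcl hz
  intro w hw
  obtain ⟨l, rfl⟩ := (Finsupp.mem_span_range_iff_exists_finsupp).1 hw
  have h1 := norm_sq_sum_smul_of_pairwise hy.2 l l.support
  have h2 := norm_sq_sum_smul_of_pairwise hAy l l.support
  have h3 : A (l.sum fun i a => a • y i) = ∑ i ∈ l.support, l i • A (y i) := by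
    simp only [Finsupp.sum, map_sum, map_smul]
  change c * ‖∑ i ∈ l.support, l i • y i‖ ≤ _ ∧ _ ≤ d * ‖∑ i ∈ l.support, l i • y i‖
  rw [h3]
  constructor
  · refine le_of_sq_le_sq ?_ (norm_nonneg _)
    rw [mul_pow, h1, h2, Finset.mul_sum]
    refine Finset.sum_le_sum fun i _ => ?_
    rw [hy.1, one_pow, mul_one, mul_comm]
    exact mul_le_mul_of_nonneg_left (pow_le_pow_left₀ hc (hcy i) 2) (sq_nonneg _)
  · refine le_of_sq_le_sq ?_ (by positivity)
    rw [mul_pow, h1, h2, Finset.mul_sum]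
    refine Finset.sum_le_sum fun i _ => ?_
    rw [hy.1, one_pow, mul_one, mul_comm (d ^ 2)]
    exact mul_le_mul_of_nonneg_left (pow_le_pow_left₀ (norm_nonneg _) (hdy i) 2) (sq_nonneg _)

/-- If the norms along the family increase strictly, the upper bound is not attained on the closed
span. -/
theorem norm_lt_of_mem_closure_span {A : H →L[ℂ] H} {y : ℕ → H} (hy : Orthonormal ℂ y)
    (hAy : Pairwise fun i j => ⟪A (y i), A (y j)⟫ = 0) {d : ℝ} (hd : 0 ≤ d)
    (hdy : ∀ n, ‖A (y n)‖ < d) {z : H}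
    (hz : z ∈ (Submodule.span ℂ (Set.range y)).topologicalClosure) (hz0 : z ≠ 0) :
    ‖A z‖ < d * ‖z‖ := by
  set N := (Submodule.span ℂ (Set.range y)).topologicalClosure with hN
  have hyN : ∀ n, y n ∈ N := fun n =>
    Submodule.le_topologicalClosure _ (Submodule.subset_span ⟨n, rfl⟩)
  -- Consequently `A` keeps the splitting `z = a • y n + w` orthogonal. The bound is strict on the
  -- first part when `a ≠ 0` and weak on the second.
  have hinner : ∀ n, ∀ w ∈ N, ⟪A (y n), A w⟫ = (‖A (y n)‖ ^ 2 : ℝ) * ⟪y n, w⟫ := by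
    intro n w hw
    have hcl : IsClosed {w : H | ⟪A (y n), A w⟫ = (‖A (y n)‖ ^ 2 : ℝ) * ⟪y n, w⟫} :=
      isClosed_eq (by fun_prop) (by fun_prop)
    refine closure_minimal
      (t := {w : H | ⟪A (y n), A w⟫ = (‖A (y n)‖ ^ 2 : ℝ) * ⟪y n, w⟫}) ?_ hcl hw
    intro w hw
    induction hw using Submodule.span_induction with
    | mem x hx =>
      obtain ⟨m, rfl⟩ := hx
      by_cases hnm : n = m
      · subst hnm
        simp only [Set.mem_ofPred_eq, inner_self_eq_norm_sq_to_K, hy.1]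
        simp
      · simp only [Set.mem_ofPred_eq, hAy hnm, hy.2 hnm, mul_zero]
    | zero => simp
    | add a b _ _ ha hb =>
      simp only [Set.mem_ofPred_eq] at ha hb ⊢
      rw [map_add, inner_add_right, inner_add_right, ha, hb, mul_add]
    | smul a b _ hb =>
      simp only [Set.mem_ofPred_eq] at hb ⊢
      rw [map_smul, inner_smul_right, inner_smul_right, hb]
      ring
  have hex : ∃ n, ⟪y n, z⟫ ≠ 0 := by
    by_contra! hcon
    apply hz0
    have hcl : IsClosed {w : H | ⟪w, z⟫ = 0} := isClosed_eq (by fun_prop) (by fun_prop)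
    have hsub : (Submodule.span ℂ (Set.range y) : Set H) ⊆ {w : H | ⟪w, z⟫ = 0} := by
      intro w hw
      induction hw using Submodule.span_induction with
      | mem x hx =>
        obtain ⟨m, rfl⟩ := hx
        exact hcon m
      | zero => simp
      | add a b _ _ ha hb =>
        simp only [Set.mem_ofPred_eq] at ha hb ⊢
        rw [inner_add_left, ha, hb, add_zero]
      | smul a b _ hb =>
        simp only [Set.mem_ofPred_eq] at hb ⊢
        rw [inner_smul_left, hb, mul_zero]
    exact inner_self_eq_zero.1 (closure_minimal hsub hcl hz)
  obtain ⟨n, hn⟩ := hex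
  set a := ⟪y n, z⟫ with ha
  set w := z - a • y n with hw
  have hwN : w ∈ N := N.sub_mem hz (N.smul_mem _ (hyN n))
  have hwy : ⟪y n, w⟫ = 0 := by
    rw [hw, inner_sub_right, inner_smul_right, inner_self_eq_norm_sq_to_K, hy.1]
    simp [ha]
  have hzw : z = a • y n + w := by rw [hw]; abel
  have h1 : ‖z‖ ^ 2 = ‖a‖ ^ 2 + ‖w‖ ^ 2 := by
    rw [hzw, @norm_add_sq ℂ, inner_smul_left, hwy, norm_smul, hy.1]
    simp
  have h2 : ‖A z‖ ^ 2 = ‖a‖ ^ 2 * ‖A (y n)‖ ^ 2 + ‖A w‖ ^ 2 := by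
    rw [hzw, map_add, map_smul, @norm_add_sq ℂ, inner_smul_left, hinner n w hwN, hwy, norm_smul]
    simp [mul_pow]
  have h3 := (norm_le_of_mem_closure_span hy hAy le_rfl hd (fun n => norm_nonneg _)
    (fun n => (hdy n).le) hwN).2
  have h4 := pow_le_pow_left₀ (norm_nonneg _) h3 2
  have h5 := pow_lt_pow_left₀ (hdy n) (norm_nonneg _) two_ne_zero
  have h6 : 0 < ‖a‖ ^ 2 := by have := norm_pos_iff.2 hn; positivity
  refine lt_of_pow_lt_pow_left₀ 2 (by positivity) ?_
  rw [mul_pow, h1, h2, mul_add]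
  rw [mul_pow] at h4
  have h7 := mul_lt_mul_of_pos_left h5 h6
  linarith

/-- A noncompact operator is bounded below at some vector of every finite-codimensional subspace,
uniformly. -/
theorem exists_le_norm_of_not_isCompactOperator [CompleteSpace H] {A : H →L[ℂ] H}
    (hA : ¬ IsCompactOperator A) :
    ∃ ε > 0, ∀ F : Submodule ℂ H, FiniteDimensional ℂ F → ∃ u ∈ Fᗮ, ε * ‖u‖ < ‖A u‖ := by
  by_contra! hcon
  refine hA (isClosed_setOfPred_isCompactOperator.closure_subset (Metric.mem_closure_iff.2 ?_))
  intro ε hε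
  obtain ⟨δ, hδ, hδε⟩ := exists_between hε
  obtain ⟨F, hF, hFA⟩ := hcon δ hδ
  -- If `A` is bounded by `δ` on `Fᗮ`, it lies within `δ` of this finite-rank operator.
  refine ⟨A.comp F.starProjection, ?_, ?_⟩
  · exact ContinuousLinearMap.isCompactOperator_of_range_subset (V := F.map (A : H →ₗ[ℂ] H))
      fun x => ⟨_, F.starProjection_apply_mem x, rfl⟩
  · rw [dist_eq_norm]
    refine lt_of_le_of_lt (ContinuousLinearMap.opNorm_le_bound _ hδ.le fun x => ?_) hδε
    have h1 := hFA _ (F.sub_starProjection_mem_orthogonal x)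
    rw [map_sub] at h1
    refine h1.trans (mul_le_mul_of_nonneg_left ?_ hδ.le)
    have h2 : x - F.starProjection x = Fᗮ.starProjection x :=
      (F.starProjection_orthogonal_val x).symm
    rw [h2]
    exact Fᗮ.norm_starProjection_apply_le x

/-- Intermediate value theorem for the ratio `‖A y‖ / ‖y‖` on a subspace. -/
theorem Submodule.exists_norm_eq_mul_norm {A : H →L[ℂ] H} {W : Submodule ℂ H} {c : ℝ} (hc : 0 ≤ c)
    {u w : H} (hu : u ∈ W) (hw : w ∈ W) (hcu : c * ‖u‖ < ‖A u‖) (hcw : ‖A w‖ < c * ‖w‖) :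
    ∃ y ∈ W, ‖y‖ = 1 ∧ ‖A y‖ = c := by
  let y : ℝ → H := fun t => ((1 - t : ℝ) : ℂ) • u + (t : ℂ) • w
  have hyc : Continuous y := by fun_prop
  have hgc : Continuous fun t => ‖A (y t)‖ - c * ‖y t‖ := by fun_prop
  have hy0 : y 0 = u := by simp [y]
  have hy1 : y 1 = w := by simp [y]
  obtain ⟨t, ht, hgt⟩ : (0 : ℝ) ∈ (fun t => ‖A (y t)‖ - c * ‖y t‖) '' Set.Icc 0 1 := by
    refine intermediate_value_Icc' zero_le_one hgc.continuousOn ⟨?_, ?_⟩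
    · rw [hy1]; linarith
    · rw [hy0]; linarith
  -- Were the segment to pass through 0, then `u` or `w` would vanish or the two would be
  -- proportional with equal ratios, against the strict inequalities.
  have hyt : y t ≠ 0 := by
    intro h0
    have h1 : (t : ℂ) • w = -(((1 - t : ℝ) : ℂ) • u) := (neg_eq_of_add_eq_zero_right h0).symm
    have h2 := congrArg norm h1
    have h3 := congrArg (fun x => ‖A x‖) h1
    simp only [map_neg, map_smul, norm_neg, norm_smul, Complex.norm_real, Real.norm_eq_abs,
      abs_of_nonneg ht.1, abs_of_nonneg (sub_nonneg.2 ht.2)] at h2 h3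
    rcases ht.1.eq_or_lt with h | h
    · rw [← h] at h3
      have h4 : ‖A u‖ = 0 := by linarith
      have := mul_nonneg hc (norm_nonneg u)
      linarith
    · have h4 := mul_lt_mul_of_pos_left hcw h
      have h5 := mul_le_mul_of_nonneg_left hcu.le (sub_nonneg.2 ht.2)
      have h6 : t * (c * ‖w‖) = (1 - t) * (c * ‖u‖) := by linear_combination c * h2
      linarith
  have hn : 0 < ‖y t‖ := norm_pos_iff.2 hyt
  have hgt' : ‖A (y t)‖ = c * ‖y t‖ := sub_eq_zero.1 hgt
  refine ⟨((‖y t‖⁻¹ : ℝ) : ℂ) • y t, W.smul_mem _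
    (W.add_mem (W.smul_mem _ hu) (W.smul_mem _ hw)), ?_, ?_⟩
  · rw [norm_smul, Complex.norm_real, norm_inv, norm_norm, inv_mul_cancel₀ hn.ne']
  · rw [map_smul, norm_smul, Complex.norm_real, norm_inv, norm_norm, hgt']
    field_simp

/-- The image of a closed subspace on which `A` is bounded below is closed. -/
theorem Submodule.isClosed_map_of_le_norm [CompleteSpace H] {A : H →L[ℂ] H} {W : Submodule ℂ H}
    (hW : IsClosed (W : Set H)) {δ : ℝ} (hδ : 0 < δ) (h : ∀ w ∈ W, δ * ‖w‖ ≤ ‖A w‖) :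
    IsClosed ((W.map (A : H →ₗ[ℂ] H) : Submodule ℂ H) : Set H) := by
  have := hW.completeSpace_coe
  let B : W →L[ℂ] H := A.comp W.subtypeL
  have hB : AntilipschitzWith (Real.toNNReal δ⁻¹) B := by
    refine ContinuousLinearMap.antilipschitz_of_bound B fun x => ?_
    rw [Real.coe_toNNReal _ (by positivity), inv_mul_eq_div, le_div_iff₀ hδ, mul_comm]
    exact h x x.2
  convert hB.isClosed_range B.uniformContinuous using 1
  ext x
  constructor
  · rintro ⟨y, hy, rfl⟩
    exact ⟨⟨y, hy⟩, rfl⟩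
  · rintro ⟨y, rfl⟩
    exact ⟨y, y.2, rfl⟩

namespace LinearPMap

theorem domain_ne_bot_of_not_isBoundedOp {T : H →ₗ.[ℂ] H} (hunb : ¬ T.IsBoundedOp) :
    T.domain ≠ ⊥ := by
  intro h
  refine hunb ⟨0, fun x => ?_⟩
  have hx : x = 0 := Subtype.ext ((Submodule.mem_bot ℂ).1 (h ▸ x.2))
  rw [hx, LinearPMap.map_zero]
  simp

variable [CompleteSpace H] {T : H →ₗ.[ℂ] H}

/-- The inverse of an unbounded operator is not bounded below on finite-codimensional subspaces. -/
theorem IsResolventAt.exists_norm_lt {A : H →L[ℂ] H} (hA : T.IsResolventAt 0 A)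
    (hdense : Dense (T.domain : Set H)) (hunb : ¬ T.IsBoundedOp) (F : Submodule ℂ H)
    [FiniteDimensional ℂ F] {δ : ℝ} (hδ : 0 < δ) : ∃ w ∈ Fᗮ, ‖A w‖ < δ * ‖w‖ := by
  by_contra! hcon
  apply hunb
  have hcl : _root_.IsClosed ((Fᗮ.map (A : H →ₗ[ℂ] H) : Submodule ℂ H) : Set H) :=
    Submodule.isClosed_map_of_le_norm F.isClosed_orthogonal hδ hcon
  -- The range is closed, being a finite-dimensional enlargement of a closed subspace, and it
  -- contains the dense domain. The open mapping theorem then makes `T` bounded.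
  have hrange : LinearMap.range (A : H →ₗ[ℂ] H) = ⊤ := by
    have e : LinearMap.range (A : H →ₗ[ℂ] H) =
        Fᗮ.map (A : H →ₗ[ℂ] H) ⊔ F.map (A : H →ₗ[ℂ] H) := by
      rw [← Submodule.map_sup, sup_comm, Submodule.sup_orthogonal_of_hasOrthogonalProjection,
        Submodule.map_top]
    have hc2 : _root_.IsClosed (LinearMap.range (A : H →ₗ[ℂ] H) : Set H) := by
      rw [e]
      exact Submodule.isClosed_sup_finiteDimensional _ _ hcl
    have hsub : (T.domain : Set H) ⊆ (LinearMap.range (A : H →ₗ[ℂ] H) : Set H) :=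
      fun x hx => ⟨T ⟨x, hx⟩, hA.inverse_apply ⟨x, hx⟩⟩
    exact SetLike.coe_injective (hc2.closure_eq ▸ (hdense.mono hsub).closure_eq)
  let e := ContinuousLinearEquiv.ofBijective A (LinearMap.ker_eq_bot.2 hA.inverse_injective) hrange
  refine ⟨‖(e.symm : H →L[ℂ] H)‖, fun x => ?_⟩
  have h1 : e.symm (x : H) = T x := by
    rw [ContinuousLinearEquiv.symm_apply_eq]
    exact (hA.inverse_apply x).symm
  rw [← h1]
  exact (e.symm : H →L[ℂ] H).le_opNorm _

/-- A noncompact inverse of an unbounded self-adjoint operator admits an orthonormal sequence with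
orthogonal images whose norms increase strictly. -/
theorem IsResolventAt.exists_orthonormal_strictMono {A : H →L[ℂ] H} (hA : T.IsResolventAt 0 A)
    (hself : IsSelfAdjoint T) (hunb : ¬ T.IsBoundedOp) (hc : ¬ IsCompactOperator A) :
    ∃ (y : ℕ → H) (ε : ℝ), Orthonormal ℂ y ∧ (Pairwise fun i j => ⟪A (y i), A (y j)⟫ = 0) ∧
      (StrictMono fun n => ‖A (y n)‖) ∧ ∀ n, ‖A (y n)‖ < ε := by
  classical
  obtain ⟨ε, hε, hF⟩ := exists_le_norm_of_not_isCompactOperator hc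
  have hsymm := hA.isSymmetric hself
  obtain ⟨y, hy1, hy2⟩ := exists_seq_of_forall_finset_exists
    (fun y : H => ‖y‖ = 1 ∧ ‖A y‖ < ε)
    (fun x y : H => ⟪x, y⟫ = 0 ∧ ⟪A x, A y⟫ = 0 ∧ ‖A x‖ < ‖A y‖) (by
      intro s hs
      obtain ⟨c, ⟨hc0, hcε⟩, hcs⟩ : ∃ c, (0 < c ∧ c < ε) ∧ ∀ x ∈ s, ‖A x‖ < c := by
        have h1 : ∀ᶠ c in 𝓝[<] ε, 0 < c ∧ c < ε :=
          Eventually.and (nhdsWithin_le_nhds (lt_mem_nhds hε)) self_mem_nhdsWithin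
        have h2 : ∀ᶠ c in 𝓝[<] ε, ∀ x ∈ s, ‖A x‖ < c :=
          (eventually_all_finset s).2 fun x hx => nhdsWithin_le_nhds (lt_mem_nhds (hs x hx).2)
        exact (h1.and h2).exists
      -- The vectors `A (A x)` are included because `⟪A x, A y⟫ = ⟪A (A x), y⟫`.
      let F : Submodule ℂ H := Submodule.span ℂ (s ∪ s.image fun x => A (A x) : Finset H)
      have hFfin : FiniteDimensional ℂ F := FiniteDimensional.span_finset ℂ _
      obtain ⟨u, hu, hAu⟩ := hF F hFfin
      obtain ⟨w, hw, hAw⟩ := hA.exists_norm_lt hself.dense_domain hunb F hc0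
      obtain ⟨y, hy, hy1, hyc⟩ := Submodule.exists_norm_eq_mul_norm hc0.le hu hw
        (lt_of_le_of_lt (mul_le_mul_of_nonneg_right hcε.le (norm_nonneg u)) hAu) hAw
      refine ⟨y, ⟨hy1, hyc.trans_lt hcε⟩, fun x hx => ⟨?_, ?_, hyc ▸ hcs x hx⟩⟩
      · exact (Submodule.mem_orthogonal _ _).1 hy x (Submodule.subset_span (by simp [hx]))
      · have h := (Submodule.mem_orthogonal _ _).1 hy (A (A x)) (Submodule.subset_span (by
          simp only [Finset.coe_union, Finset.coe_image]
          exact Or.inr ⟨x, hx, rfl⟩))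
        exact (hsymm (A x) y).symm.trans h)
  have hsymP : ∀ i j, i ≠ j → ⟪y i, y j⟫ = 0 ∧ ⟪A (y i), A (y j)⟫ = 0 := by
    intro i j hij
    rcases lt_or_gt_of_ne hij with h | h
    · exact ⟨(hy2 i j h).1, (hy2 i j h).2.1⟩
    · exact ⟨inner_eq_zero_symm.1 (hy2 j i h).1, inner_eq_zero_symm.1 (hy2 j i h).2.1⟩
  exact ⟨y, ε, ⟨fun n => (hy1 n).1, fun i j hij => (hsymP i j hij).1⟩,
    fun i j hij => (hsymP i j hij).2, fun i j hij => (hy2 i j hij).2.2, fun n => (hy1 n).2⟩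

/-- An injective, unbounded, absolutely minimum attaining self-adjoint operator has a compact
inverse. -/
theorem IsAbsMinAttaining.exists_compact_inverse (hself : IsSelfAdjoint T)
    (hinj : Function.Injective T) (hunb : ¬ T.IsBoundedOp) (hmin : T.IsAbsMinAttaining) :
    ∃ A, T.IsResolventAt 0 A ∧ IsCompactOperator A := by
  obtain ⟨A, hA⟩ : ∃ A, T.IsResolventAt 0 A := by
    obtain ⟨x, hx1, hx2⟩ := hmin ⊤ isClosed_univ
      (by rw [top_inf_eq]; exact domain_ne_bot_of_not_isBoundedOp hunb)
    have hpos : 0 < (T.domRestrict ⊤).minModulus := by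
      have h1 : T.domRestrict ⊤ x = T ⟨x, x.2.2⟩ := domRestrict_apply rfl
      rw [← hx2, h1, norm_pos_iff]
      intro h0
      have h2 := congrArg Subtype.val (hinj (h0.trans T.map_zero.symm))
      have h3 : (x : H) = 0 := h2
      rw [h3, norm_zero] at hx1
      exact zero_ne_one hx1
    refine exists_isResolventAt_zero hself hinj hpos fun x => ?_
    have h1 := minModulus_le (S := T.domRestrict ⊤) ⟨x, trivial, x.2⟩
    have h2 : T.domRestrict ⊤ ⟨x, trivial, x.2⟩ = T x := domRestrict_apply rfl
    rwa [h2] at h1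
  refine ⟨A, hA, ?_⟩
  by_contra hc
  obtain ⟨y, ε, hy, hAy, hmono, hlt⟩ := hA.exists_orthonormal_strictMono hself hunb hc
  set κ := ⨆ n, ‖A (y n)‖ with hκ
  have hbdd : BddAbove (Set.range fun n => ‖A (y n)‖) := ⟨ε, by rintro _ ⟨n, rfl⟩; exact (hlt n).le⟩
  have htend : Tendsto (fun n => ‖A (y n)‖) atTop (𝓝 κ) := tendsto_atTop_ciSup hmono.monotone hbdd
  have hκlt : ∀ n, ‖A (y n)‖ < κ := fun n =>
    (hmono (Nat.lt_succ_self n)).trans_le (le_ciSup hbdd (n + 1))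
  have hA0 : ∀ {x}, x ≠ 0 → A x ≠ 0 := fun hx h =>
    hx (hA.inverse_injective (h.trans (_root_.map_zero A).symm))
  have hpos : ∀ n, 0 < ‖A (y n)‖ := fun n => norm_pos_iff.2 (hA0 (hy.ne_zero n))
  have hκ0 : 0 ≤ κ := ((hpos 0).trans (hκlt 0)).le
  set N := (Submodule.span ℂ (Set.range y)).topologicalClosure with hN
  have hyN : ∀ n, y n ∈ N := fun n =>
    Submodule.le_topologicalClosure _ (Submodule.subset_span ⟨n, rfl⟩)
  have hM : _root_.IsClosed ((N.map (A : H →ₗ[ℂ] H) : Submodule ℂ H) : Set H) :=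
    Submodule.isClosed_map_of_le_norm (Submodule.isClosed_topologicalClosure _) (hpos 0)
      fun w hw => (norm_le_of_mem_closure_span hy hAy (norm_nonneg (A (y 0))) hκ0
        (fun n => hmono.monotone (Nat.zero_le n)) (fun n => (hκlt n).le) hw).1
  set S := T.domRestrict (N.map (A : H →ₗ[ℂ] H)) with hS
  obtain ⟨x, hx1, hx2⟩ : S.IsMinAttaining := hmin _ hM (by
    rw [Submodule.ne_bot_iff]
    exact ⟨A (y 0), ⟨⟨y 0, hyN 0, rfl⟩, hA.mem_domain _⟩, hA0 (hy.ne_zero 0)⟩)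
  obtain ⟨z, hzN, hzx⟩ := x.2.1
  have hzx' : A z = x := hzx
  have hSx : S x = z := by
    have h1 : S x = T ⟨x, x.2.2⟩ := domRestrict_apply rfl
    rw [h1]
    have h2 : (⟨x, x.2.2⟩ : T.domain) = ⟨A z, hA.mem_domain z⟩ := Subtype.ext hzx'.symm
    rw [h2, hA.apply_inverse]
  have hle : ∀ n, S.minModulus * ‖A (y n)‖ ≤ 1 := by
    intro n
    have h1 := minModulus_le (S := S) ⟨A (y n), ⟨y n, hyN n, rfl⟩, hA.mem_domain _⟩
    have h2 : S ⟨A (y n), ⟨y n, hyN n, rfl⟩, hA.mem_domain _⟩ = y n :=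
      (domRestrict_apply (y := ⟨A (y n), hA.mem_domain _⟩) rfl).trans (hA.apply_inverse _)
    rwa [h2, hy.1] at h1
  have hle' : S.minModulus * κ ≤ 1 := le_of_tendsto' (htend.const_mul _) hle
  have hz0 : z ≠ 0 := by
    rintro rfl
    rw [_root_.map_zero] at hzx'
    rw [← hzx', norm_zero] at hx1
    exact zero_ne_one hx1
  -- A minimizer `x = A z` would give `1 = ‖A z‖ < κ * ‖z‖ = κ * S.minModulus ≤ 1`.
  have h := norm_lt_of_mem_closure_span hy hAy hκ0 hκlt hzN hz0
  rw [hzx', hx1] at h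
  rw [hSx] at hx2
  rw [hx2, mul_comm] at h
  linarith

end LinearPMap

end

/-! ### The equivalence -/

theorem theorem4p11 {H : Type*} [NormedAddCommGroup H] [InnerProductSpace ℂ H] [CompleteSpace H]
    (T : H →ₗ.[ℂ] H) (hself : IsSelfAdjoint T) (hinj : Function.Injective T)
    (hunb : ¬ T.IsBoundedOp) :
    List.TFAE [
      T.IsAbsMinAttaining,
      T.inverse.MemCompact,
      ∃ (lam : ℕ → ℝ) (v : HilbertBasis ℕ ℂ H),
        Tendsto (fun n => |lam n|) atTop atTop ∧
          ∀ n, ∃ hn : v n ∈ T.domain, T ⟨v n, hn⟩ = (lam n : ℂ) • v n,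
      T.HasPurelyDiscreteSpectrum,
      ∃ z ∈ T.resolventSet, (T.resolventOp z).MemCompact,
      ∀ z ∈ T.resolventSet, (T.resolventOp z).MemCompact,
      IsCompactOperator (LinearPMap.GraphDomain.embedding T)] := by
  rw [LinearPMap.memCompact_inverse_iff hinj]
  tfae_have 1 → 2 := fun h => h.exists_compact_inverse hself hinj hunb
  tfae_have 2 → 3 := fun ⟨_, hA, hc⟩ => hA.exists_hilbertBasis hself hunb hc
  tfae_have 3 → 4 := fun ⟨_, v, hlam, hv⟩ =>
    LinearPMap.hasPurelyDiscreteSpectrum_of_hilbertBasis hself v hlam hv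
  tfae_have 4 → 2 := fun h => h.exists_compact_inverse hself hinj
  tfae_have 2 → 6 := by
    rintro ⟨A, hA, hc⟩ z hz
    obtain ⟨R, hR⟩ := LinearPMap.mem_resolventSet_iff.1 hz
    exact hR.memCompact_iff.2 (hA.isCompactOperator hR hc)
  -- Passing from all resolvents to some resolvent requires a nonempty resolvent set.
  tfae_have 6 → 5 := fun h =>
    ⟨Complex.I, LinearPMap.I_mem_resolventSet hself, h _ (LinearPMap.I_mem_resolventSet hself)⟩
  tfae_have 5 → 7 := by
    rintro ⟨z, hz, hc⟩
    obtain ⟨R, hR⟩ := LinearPMap.mem_resolventSet_iff.1 hz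
    exact hR.isCompactOperator_embedding (hR.memCompact_iff.1 hc)
  tfae_have 7 → 1 := LinearPMap.isAbsMinAttaining_of_isCompactOperator_embedding hself.isClosed
  tfae_finish
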